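/- Let $\bar M$ be a monster model of a complete first-order theory $T$ in a language $L$: for some uncountable cardinal $\kappa>|L|$, $\bar M$ is $\kappa$-saturated; a subset of $\bar M$ is small if it has fewer than $\kappa$ elements. All tuples are finite, and $A,B$ denote small sets. A global type is a complete type over $\bar M$ in finitely many variables, and $\mathfrak p_{\upharpoonright A}$ is its restriction to $A$. We use the following notions. - $\mathfrak p$ is $A$-invariant if $\phi(\bar x,\bar b_1)\in\mathfrak p\Leftrightarrow\phi(\bar x,\bar b_2)\in\mathfrak p$ whenever $\phi(\bar x,\bar y)$ is over $A$ and $\mathrm{tp}(\bar b_1/A)=\mathrm{tp}(\bar b_2/A)$; it is invariant if it is $A$-invariant for some small $A$. - For invariant $\mathfrak q(\bar y),\mathfrak r(\bar z)$, the product $\mathfrak q\otimes\mathfrak r$ is $\mathrm{tp}(\bar b,\bar c/\bar M)$, where $\bar b\models\mathfrak q$ and $\bar c\models\mathfrak r_{\upharpoonright\bar M\bar b}$ (in an elementary extension). Equivalently, if $\mathfrak r$ is $A$-invariant, $\phi(\bar y,\bar z)$ is over $A$ and $\bar b\models\mathfrak q_{\upharpoonright A}$, then $\phi(\bar y,\bar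 z)\in\mathfrak q\otimes\mathfrak r$ iff $\phi(\bar b,\bar z)\in\mathfrak r$. - $\mathfrak p$ is non-algebraic if none of its formulas has only finitely many solutions. - A non-algebraic $\mathfrak p$ is regular over $A$ if it is $A$-invariant and, for all small $B\supseteq A$ and all $a\models\mathfrak p_{\upharpoonright A}$, either $a\models\mathfrak p_{\upharpoonright B}$ or $\mathfrak p_{\upharpoonright B}\vdash\mathfrak p_{\upharpoonright Ba}$; it is regular if it is regular over some small set. - A non-algebraic $\mathfrak p$ is generically stable if, for some small $A$, it is $A$-invariant and, for every infinite ordinal $\alpha<\kappa$, every Morley sequence $(a_i\mid i<\alpha)$ in $\mathfrak p$ over $A$ (that is, $a_i\models\mathfrak p_{\upharpoonright Aa_{<i}}$ for all $i<\alpha$) and every formula $\phi(x)$ with parameters from $\bar M$, the set $\{i<\alpha\mid\ \models\phi(a_i)\}$ is finite or cofinite. - Global types $\mathfrak p(\bar x),\mathfrak q(\bar y)$ are orthogonal, $\mathfrak p\perp\mathfrak q$, if $\mathfrak p(\bar x)\cup\mathfrak q(\bar y)$ determines a complete type over $\bar M$. **Proposition** (generically stable regular types have weight one). Suppose that $\mathfrak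 p,\mathfrak q,\mathfrak r$ are (not necessarily distinct) $A$-invariant global types, where $A$ is small, and that $\mathfrak p$ is regular over $A$ and generically stable. Let $(\bar b,\bar c)\models(\mathfrak q\otimes\mathfrak r)_{\upharpoonright A}$ and $a\models\mathfrak p_{\upharpoonright A}$. Then $a\models\mathfrak p_{\upharpoonright A\bar b}$ or $a\models\mathfrak p_{\upharpoonright A\bar c}$. **Corollary.** Suppose that $\mathfrak p,\mathfrak q,\mathfrak r$ are invariant global types and that $\mathfrak p$ is regular and generically stable. Then $\mathfrak p\perp\mathfrak q\otimes\mathfrak r$ if and only if $\mathfrak p\perp\mathfrak q$ and $\mathfrak p\perp\mathfrak r$. -/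

import Mathlib

open FirstOrder FirstOrder.Language Cardinal

namespace MonsterModel

universe u v w x y z

section Basic

variable {L : FirstOrder.Language.{u, v}} {M : Type w} [L.Structure M] {α : Type x} {β : Type y}

/-- `M` is `κ`-saturated: every set of formulas in finitely many variables, with parameters from a
set of fewer than `κ` elements, which is finitely satisfiable in `M`, is realized in `M`. -/
def IsSaturated (L : FirstOrder.Language.{u, v}) (M : Type w) [L.Structure M] (κ : Cardinal.{w}) : Prop :=
  ∀ A : Set M, #A < κ → ∀ (n : ℕ) (Φ : Set (L.Formula (A ⊕ Fin n))),
    (∀ Φ₀ : Finset (L.Formula (A ⊕ Fin n)), (Φ₀ : Set (L.Formula (A ⊕ Fin n))) ⊆ Φ →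
      ∃ a : Fin n → M, ∀ φ ∈ Φ₀, φ.Realize (Sum.elim (fun m : A => (m : M)) a)) →
    ∃ a : Fin n → M, ∀ φ ∈ Φ, φ.Realize (Sum.elim (fun m : A => (m : M)) a)

/-- `M` is a monster model (of its complete theory) with respect to `κ`; subsets of `M` with
fewer than `κ` elements are called small. -/
structure IsMonster (L : FirstOrder.Language.{u, v}) (M : Type w) [L.Structure M] (κ : Cardinal.{w}) :
    Prop where
  aleph0_lt : ℵ₀ < κ
  card_lt : Cardinal.lift.{w} L.card < Cardinal.lift.{max u v} κ
  saturated : IsSaturated L M κ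

/-- A global type in the variables `α`: a complete type over the whole of `M`. -/
abbrev GlobalType (L : FirstOrder.Language.{u, v}) (M : Type w) [L.Structure M] (α : Type x) :=
  (L.elementaryDiagram M).CompleteType α

/-- Formulas in the variables `α` with parameters from `M` are presented as `L`-formulas in the
variables `M ⊕ α`, where a variable `m : M` stands for the parameter `m`. -/
def toSentence : L.Formula (M ⊕ α) ≃ L[[M]][[α]].Sentence :=
  BoundedFormula.constantsVarsEquiv.symm.trans Formula.equivSentence

/-- The formula `φ` with parameters from `M` belongs to the global type `p`. -/
def Has (p : GlobalType L M α) (φ : L.Formula (M ⊕ α)) : Prop :=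
  toSentence φ ∈ p

/-- `a ⊨ p ↾ A`, for a tuple `a` of elements of `M`. -/
def Realizes (p : GlobalType L M α) (A : Set M) (a : α → M) : Prop :=
  ∀ φ : L.Formula (A ⊕ α), Has p (φ.relabel (Sum.map (fun m : A => (m : M)) id)) →
    φ.Realize (Sum.elim (fun m : A => (m : M)) a)

/-- `b₁ ≡ b₂ (A)`: the tuples have the same type over `A`. -/
def SameType (L : FirstOrder.Language.{u, v}) {M : Type w} [L.Structure M] (A : Set M) (b₁ b₂ : α → M) :
    Prop :=
  ∀ φ : L.Formula (A ⊕ α), φ.Realize (Sum.elim (fun m : A => (m : M)) b₁) ↔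
    φ.Realize (Sum.elim (fun m : A => (m : M)) b₂)

/-- `p` is `A`-invariant: for `φ(z, x)` over `A` and finite tuples `b₁ ≡ b₂ (A)`,
`φ(b₁, x) ∈ p` if and only if `φ(b₂, x) ∈ p`. -/
def InvariantOver (p : GlobalType L M α) (A : Set M) : Prop :=
  ∀ (n : ℕ) (b₁ b₂ : Fin n → M), SameType L A b₁ b₂ → ∀ φ : L.Formula ((A ⊕ Fin n) ⊕ α),
    (Has p (φ.relabel (Sum.map (Sum.elim (fun m : A => (m : M)) b₁) id)) ↔
      Has p (φ.relabel (Sum.map (Sum.elim (fun m : A => (m : M)) b₂) id)))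

/-- `p` is invariant over some small set. -/
def Invariant (κ : Cardinal.{w}) (p : GlobalType L M α) : Prop :=
  ∃ A : Set M, #A < κ ∧ InvariantOver p A

/-- No formula of `p` has only finitely many solutions. -/
def NonAlgebraic (p : GlobalType L M α) : Prop :=
  ∀ φ : L.Formula (M ⊕ α), Has p φ → {a : α → M | φ.Realize (Sum.elim id a)}.Infinite

/-- `p` is regular over the small set `A`. Here `p ↾ B ⊢ p ↾ Ba` says that every realization of
`p ↾ B` in the monster model realizes `p ↾ Ba`. -/
def RegularOver (κ : Cardinal.{w}) (p : GlobalType L M α) (A : Set M) : Prop :=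
  NonAlgebraic p ∧ InvariantOver p A ∧
    ∀ B : Set M, #B < κ → A ⊆ B → ∀ a : α → M, Realizes p A a →
      Realizes p B a ∨ ∀ a' : α → M, Realizes p B a' → Realizes p (B ∪ Set.range a) a'

/-- `p` is regular: regular over some small set. -/
def Regular (κ : Cardinal.{w}) (p : GlobalType L M α) : Prop :=
  ∃ A : Set M, #A < κ ∧ RegularOver κ p A

/-- `(a i)` is a Morley sequence in `p` over `A`: `a i ⊨ p ↾ A a_{<i}` for all `i`. -/
def IsMorley (p : GlobalType L M α) (A : Set M) {I : Type w} [LinearOrder I]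
    (a : I → α → M) : Prop :=
  ∀ i, Realizes p (A ∪ ⋃ j : Set.Iio i, Set.range (a j)) (a i)

/-- `p` is generically stable. The infinite ordinals indexing Morley sequences are presented as
infinite well-ordered sets `I` of small cardinality. -/
def GenericallyStable (κ : Cardinal.{w}) (p : GlobalType L M α) : Prop :=
  NonAlgebraic p ∧ ∃ A : Set M, #A < κ ∧ InvariantOver p A ∧
    ∀ (I : Type w) [LinearOrder I] [WellFoundedLT I] [Infinite I], #I < κ →
      ∀ a : I → α → M, IsMorley p A a → ∀ φ : L.Formula (M ⊕ α),
        {i | φ.Realize (Sum.elim id (a i))}.Finite ∨ {i | φ.Realize (Sum.elim id (a i))}ᶜ.Finite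

/-- Global types `p(x)` and `q(y)` are orthogonal: `p(x) ∪ q(y)` determines a complete global
type in the variables `x, y`. -/
def Orthogonal (p : GlobalType L M α) (q : GlobalType L M β) : Prop :=
  ∃! s : GlobalType L M (α ⊕ β),
    (∀ φ : L.Formula (M ⊕ α), Has p φ → Has s (φ.relabel (Sum.map id Sum.inl))) ∧
    (∀ φ : L.Formula (M ⊕ β), Has q φ → Has s (φ.relabel (Sum.map id Sum.inr)))

/-- Substitution of a tuple `a` from `M` for the variables `x` of a formula `φ(x, y)`. -/
def substLeft (φ : L.Formula (M ⊕ (α ⊕ β))) (a : α → M) : L.Formula (M ⊕ β) :=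
  φ.relabel (Sum.elim Sum.inl (Sum.map a id))

/-- `φ(x, y) ∈ p(x) ⊗ q(y)`: for some small set `D`, `φ(a, y) ∈ q` whenever `a ⊨ p ↾ D`. -/
def ProdHas (κ : Cardinal.{w}) (p : GlobalType L M α) (q : GlobalType L M β)
    (φ : L.Formula (M ⊕ (α ⊕ β))) : Prop :=
  ∃ D : Set M, #D < κ ∧ ∀ a : α → M, Realizes p D a → Has q (substLeft φ a)

end Basic

section Product

variable {L : FirstOrder.Language.{u, v}} {M : Type w} [L.Structure M] {α : Type x} {β : Type y}

theorem has_not (p : GlobalType L M α) (φ : L.Formula (M ⊕ α)) :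
    Has p φ.not ↔ ¬ Has p φ :=
  p.not_mem_iff (toSentence φ)

theorem has_typeOf [Nonempty M] (a : α → M) (φ : L.Formula (M ⊕ α)) :
    toSentence φ ∈ (L.elementaryDiagram M).typeOf a ↔ φ.Realize (Sum.elim id a) := by
  rw [toSentence, Equiv.trans_apply, Theory.CompleteType.formula_mem_typeOf]
  have h := BoundedFormula.realize_constantsVarsEquiv (L := L) (α := M) (M := M)
    (φ := BoundedFormula.constantsVarsEquiv.symm φ) (v := a) (xs := default)
  rw [Equiv.apply_symm_apply] at h
  exact h.symm

/-- A global type is finitely satisfiable in `M`. -/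
theorem exists_realize [Finite α] (p : GlobalType L M α)
    (s : Finset (L.Formula (M ⊕ α))) (hs : ∀ φ ∈ s, Has p φ) :
    ∃ a : α → M, ∀ φ ∈ s, φ.Realize (Sum.elim id a) := by
  obtain ⟨N, a, ha⟩ := Theory.exists_modelType_is_realized_in _ p
  let _ : L.Structure N := (L.lhomWithConstants M).reduct N
  have : (L.lhomWithConstants M).IsExpansionOn N := LHom.isExpansionOn_reduct _ _
  let e : M ↪ₑ[L] N := ElementaryEmbedding.ofModelsElementaryDiagram L M N
  have key : ∀ φ : L.Formula (M ⊕ α), Has p φ → φ.Realize (Sum.elim e a) := by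
    intro φ hφ
    rw [Has, ← ha, toSentence, Equiv.trans_apply, Theory.CompleteType.formula_mem_typeOf] at hφ
    have h := BoundedFormula.realize_constantsVarsEquiv (L := L) (α := M) (M := N)
      (φ := BoundedFormula.constantsVarsEquiv.symm φ) (v := a) (xs := default)
    rw [Equiv.apply_symm_apply] at h
    exact h.2 hφ
  have h2 : ((Formula.iInf (fun φ : s => (φ : L.Formula (M ⊕ α)))).iExs α).Realize (e ∘ id) := by
    rw [Formula.realize_iExs]
    refine ⟨a, ?_⟩
    rw [Formula.realize_iInf]
    intro φ
    exact key _ (hs _ φ.2)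
  rw [e.map_formula, Formula.realize_iExs] at h2
  obtain ⟨b, hb⟩ := h2
  rw [Formula.realize_iInf] at hb
  exact ⟨b, fun φ hφ => hb ⟨φ, hφ⟩⟩

theorem has_congr [Finite α] (p : GlobalType L M α) {φ ψ : L.Formula (M ⊕ α)}
    (h : ∀ a : α → M, φ.Realize (Sum.elim id a) ↔ ψ.Realize (Sum.elim id a)) :
    Has p φ ↔ Has p ψ := by
  classical
  have aux : ∀ {φ ψ : L.Formula (M ⊕ α)},
      (∀ a : α → M, φ.Realize (Sum.elim id a) ↔ ψ.Realize (Sum.elim id a)) →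
      Has p φ → Has p ψ := by
    intro φ ψ h hφ
    by_contra hψ
    obtain ⟨a, ha⟩ := exists_realize p {φ, ψ.not} (by
      intro χ hχ
      simp only [Finset.mem_insert, Finset.mem_singleton] at hχ
      rcases hχ with rfl | rfl
      · exact hφ
      · exact (has_not p ψ).2 hψ)
    have h1 := ha φ (by simp)
    have h2 := ha ψ.not (by simp)
    rw [Formula.realize_not] at h2
    exact h2 ((h a).1 h1)
  exact ⟨aux h, aux fun a => (h a).symm⟩

theorem realizes_iff (p : GlobalType L M α) (A : Set M) (a : α → M) (ha : Realizes p A a)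
    (φ : L.Formula (A ⊕ α)) :
    φ.Realize (Sum.elim (fun m : A => (m : M)) a) ↔
      Has p (φ.relabel (Sum.map (fun m : A => (m : M)) id)) := by
  refine ⟨fun h => ?_, ha φ⟩
  by_contra hn
  have h' := ha φ.not ((has_not p _).2 hn)
  rw [Formula.realize_not] at h'
  exact h' h

theorem Realizes.mono [Finite α] {p : GlobalType L M α} {A B : Set M} {a : α → M}
    (h : Realizes p B a) (hAB : A ⊆ B) : Realizes p A a := by
  intro φ hφ
  have h' := h (φ.relabel (Sum.map (Set.inclusion hAB) id)) ((has_congr p fun b => by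
    simp only [Formula.realize_relabel]
    exact iff_of_eq (congrArg _ (by ext i; cases i <;> rfl))).1 hφ)
  rw [Formula.realize_relabel] at h'
  exact (iff_of_eq (congrArg _ (by ext i; cases i <;> rfl))).1 h'

/-- In a saturated model, the restriction of a global type to a small set is realized. -/
theorem exists_realizes [Finite α] {κ : Cardinal.{w}} (hM : IsSaturated L M κ)
    (p : GlobalType L M α) {A : Set M} (hA : #A < κ) : ∃ a : α → M, Realizes p A a := by
  classical
  obtain ⟨n, ⟨e⟩⟩ := Finite.exists_equiv_fin α
  obtain ⟨a, ha⟩ := hM A hA n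
    {φ | Has p (φ.relabel (Sum.map (fun m : A => (m : M)) e.symm))} (by
      intro Φ₀ hΦ
      obtain ⟨a, ha⟩ := exists_realize p
        (Φ₀.image fun φ => φ.relabel (Sum.map (fun m : A => (m : M)) e.symm)) (by
          intro φ hφ
          obtain ⟨ψ, hψ, rfl⟩ := Finset.mem_image.1 hφ
          exact hΦ hψ)
      refine ⟨a ∘ e.symm, fun φ hφ => ?_⟩
      have h := ha _ (Finset.mem_image_of_mem _ hφ)
      rw [Formula.realize_relabel] at h
      exact (iff_of_eq (congrArg _ (by ext i; cases i <;> rfl))).1 h)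
  refine ⟨a ∘ e, fun φ hφ => ?_⟩
  have h := ha (φ.relabel (Sum.map id e)) ((has_congr p fun b => by
    simp only [Formula.realize_relabel]
    exact iff_of_eq (congrArg _ (by ext i; cases i <;> simp))).1 hφ)
  rw [Formula.realize_relabel] at h
  exact (iff_of_eq (congrArg _ (by ext i; cases i <;> rfl))).1 h

/-- A formula with parameters involves only finitely many of them. -/
theorem exists_params {γ : Type z} (φ : L.Formula (M ⊕ γ)) :
    ∃ (n : ℕ) (c : Fin n → M) (ψ : L.Formula (Fin n ⊕ γ)),
      ∀ e : γ → M, φ.Realize (Sum.elim id e) ↔ ψ.Realize (Sum.elim c e) := by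
  classical
  let s : Finset M := (BoundedFormula.freeVarFinset φ).toLeft
  let g : s ≃ Fin s.card := s.equivFin
  let f : BoundedFormula.freeVarFinset φ → Fin s.card ⊕ γ := fun t =>
    match t with
    | ⟨Sum.inl m, h⟩ => Sum.inl (g ⟨m, Finset.mem_toLeft.2 h⟩)
    | ⟨Sum.inr i, _⟩ => Sum.inr i
  refine ⟨s.card, fun i => (g.symm i : M), BoundedFormula.restrictFreeVar φ f, fun e => ?_⟩
  refine (BoundedFormula.realize_restrictFreeVar (Sum.elim id e) ?_).symm
  rintro ⟨m | i, h⟩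
  · simp [f]
  · simp [f]

/-- Over a set `D` containing `A` and the parameters of `φ`, the truth of `φ(a, y) ∈ q` does not
depend on the choice of `a ⊨ p ↾ D`. -/
theorem exists_finite_has_iff [Finite α] [Finite β] (p : GlobalType L M α) (q : GlobalType L M β)
    {A : Set M} (hq : InvariantOver q A) (φ : L.Formula (M ⊕ (α ⊕ β))) :
    ∃ C : Set M, C.Finite ∧ ∀ a₁ a₂ : α → M, Realizes p (A ∪ C) a₁ → Realizes p (A ∪ C) a₂ →
      (Has q (substLeft φ a₁) ↔ Has q (substLeft φ a₂)) := by
  obtain ⟨n, c, ψ, hψ⟩ := exists_params φ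
  obtain ⟨k, ⟨e⟩⟩ := Finite.exists_equiv_fin α
  refine ⟨Set.range c, Set.finite_range c, fun a₁ a₂ h₁ h₂ => ?_⟩
  let b : (α → M) → Fin (n + k) → M := fun a => Fin.append c (a ∘ e.symm)
  let χ : L.Formula ((A ⊕ Fin (n + k)) ⊕ β) := ψ.relabel
    (Sum.elim (fun i => Sum.inl (Sum.inr (Fin.castAdd k i)))
      (Sum.elim (fun i => Sum.inl (Sum.inr (Fin.natAdd n (e i)))) Sum.inr))
  have hχ : ∀ a : α → M, Has q (substLeft φ a) ↔
      Has q (χ.relabel (Sum.map (Sum.elim (fun m : A => (m : M)) (b a)) id)) := by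
    intro a
    refine has_congr q fun d => ?_
    simp only [substLeft, χ, Formula.realize_relabel]
    have h := hψ (Sum.elim a d)
    refine Iff.trans (iff_of_eq (congrArg _ ?_)) (h.trans (iff_of_eq (congrArg _ ?_)))
    · ext i; rcases i with i | i | i <;> rfl
    · ext i; rcases i with i | i | i <;> simp [b]
  rw [hχ a₁, hχ a₂]
  refine hq _ _ _ (fun θ => ?_) χ
  let g : A ⊕ Fin (n + k) → ↥(A ∪ Set.range c) ⊕ α :=
    Sum.elim (fun m => Sum.inl ⟨m, Or.inl m.2⟩)
      (Fin.addCases (fun i => Sum.inl ⟨c i, Or.inr ⟨i, rfl⟩⟩) (fun i => Sum.inr (e.symm i)))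
  have hg : ∀ a : α → M, θ.Realize (Sum.elim (fun m : A => (m : M)) (b a)) ↔
      (θ.relabel g).Realize (Sum.elim (fun m : ↥(A ∪ Set.range c) => (m : M)) a) := by
    intro a
    rw [Formula.realize_relabel]
    refine iff_of_eq (congrArg _ ?_)
    ext i
    rcases i with i | i
    · rfl
    · refine Fin.addCases (fun i => ?_) (fun i => ?_) i <;> simp [b, g]
  rw [hg a₁, hg a₂, realizes_iff p _ _ h₁, realizes_iff p _ _ h₂]

theorem small_union {κ : Cardinal.{w}} (hκ : ℵ₀ < κ) {A C : Set M} (hA : #A < κ)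
    (hC : C.Finite) : #↥(A ∪ C) < κ :=
  (mk_union_le A C).trans_lt
    (add_lt_of_lt hκ.le hA ((lt_aleph0_iff_set_finite.2 hC).trans hκ))

theorem prodHas_or_not [Finite α] [Finite β] {κ : Cardinal.{w}} (hM : IsMonster L M κ)
    (p : GlobalType L M α) (q : GlobalType L M β) (hq : Invariant κ q)
    (φ : L.Formula (M ⊕ (α ⊕ β))) : ProdHas κ p q φ ∨ ProdHas κ p q φ.not := by
  obtain ⟨A, hA, hqA⟩ := hq
  obtain ⟨C, hC, h⟩ := exists_finite_has_iff p q hqA φ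
  have hD := small_union hM.aleph0_lt hA hC
  obtain ⟨a₀, ha₀⟩ := exists_realizes hM.saturated p hD
  by_cases h₀ : Has q (substLeft φ a₀)
  · exact Or.inl ⟨A ∪ C, hD, fun a ha => (h a₀ a ha₀ ha).1 h₀⟩
  · refine Or.inr ⟨A ∪ C, hD, fun a ha => ?_⟩
    exact (has_not q _).2 fun h' => h₀ ((h a₀ a ha₀ ha).2 h')

theorem exists_realize_of_prodHas [Finite α] [Finite β] {κ : Cardinal.{w}}
    (hM : IsMonster L M κ) (p : GlobalType L M α) (q : GlobalType L M β)
    (s : Finset (L.Formula (M ⊕ (α ⊕ β)))) (hs : ∀ φ ∈ s, ProdHas κ p q φ) :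
    ∃ d : α ⊕ β → M, ∀ φ ∈ s, φ.Realize (Sum.elim id d) := by
  classical
  have hD : ∃ D : Set M, #D < κ ∧
      ∀ a : α → M, Realizes p D a → ∀ φ ∈ s, Has q (substLeft φ a) := by
    induction s using Finset.induction_on with
    | empty => exact ⟨∅, by simpa using aleph0_pos.trans hM.aleph0_lt, by simp⟩
    | insert φ s _ ih =>
      obtain ⟨D₁, h₁, h₁'⟩ := ih fun ψ hψ => hs ψ (Finset.mem_insert_of_mem hψ)
      obtain ⟨D₂, h₂, h₂'⟩ := hs φ (Finset.mem_insert_self _ _)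
      refine ⟨D₁ ∪ D₂, (mk_union_le _ _).trans_lt (add_lt_of_lt hM.aleph0_lt.le h₁ h₂), ?_⟩
      intro a ha ψ hψ
      rcases Finset.mem_insert.1 hψ with rfl | hψ
      · exact h₂' a (ha.mono Set.subset_union_right)
      · exact h₁' a (ha.mono Set.subset_union_left) ψ hψ
  obtain ⟨D, hDκ, hD⟩ := hD
  obtain ⟨a, ha⟩ := exists_realizes hM.saturated p hDκ
  obtain ⟨b, hb⟩ := exists_realize q (s.image fun φ => substLeft φ a) (by
    intro φ hφ
    obtain ⟨ψ, hψ, rfl⟩ := Finset.mem_image.1 hφ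
    exact hD a ha ψ hψ)
  refine ⟨Sum.elim a b, fun φ hφ => ?_⟩
  have h := hb _ (Finset.mem_image_of_mem _ hφ)
  rw [substLeft, Formula.realize_relabel] at h
  exact (iff_of_eq (congrArg _ (by ext i; rcases i with i | i | i <;> rfl))).1 h

/-- The product `p(x) ⊗ q(y)` of a global type `p` and an invariant global type `q`, in the order
in which `(a, b) ⊨ (p ⊗ q) ↾ A` means `a ⊨ p ↾ A` and `b ⊨ q ↾ Aa`. -/
def prod [Nonempty M] [Finite α] [Finite β] {κ : Cardinal.{w}} (hM : IsMonster L M κ)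
    (p : GlobalType L M α) (q : GlobalType L M β) (hq : Invariant κ q) :
    GlobalType L M (α ⊕ β) where
  toTheory := {σ | ProdHas κ p q (toSentence.symm σ)}
  subset' := by
    intro σ hσ
    by_contra hn
    have h := (prodHas_or_not hM p q hq (toSentence.symm σ)).resolve_left hn
    obtain ⟨d, hd⟩ := exists_realize_of_prodHas hM p q {(toSentence.symm σ).not} (by simpa using h)
    have h1 := hd _ (Finset.mem_singleton_self _)
    rw [Formula.realize_not, ← has_typeOf, Equiv.apply_symm_apply] at h1
    exact h1 (((L.elementaryDiagram M).typeOf d).subset hσ)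
  isMaximal' := by
    classical
    refine ⟨?_, fun σ => prodHas_or_not hM p q hq (toSentence.symm σ)⟩
    rw [Theory.isSatisfiable_iff_isFinitelySatisfiable]
    intro T₀ hT₀
    obtain ⟨d, hd⟩ := exists_realize_of_prodHas hM p q (T₀.image toSentence.symm) (by
      intro φ hφ
      obtain ⟨σ, hσ, rfl⟩ := Finset.mem_image.1 hφ
      exact hT₀ hσ)
    refine ((L.elementaryDiagram M).typeOf d).isMaximal.1.mono fun σ hσ => ?_
    have h := hd _ (Finset.mem_image_of_mem _ hσ)
    rw [← has_typeOf, Equiv.apply_symm_apply] at h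
    exact h

/-- The textbook description of the product: for `q` invariant over the small set `A`, a formula
`φ(x, y)` over `A` and any `a ⊨ p ↾ A`, `φ(x, y) ∈ p ⊗ q` if and only if `φ(a, y) ∈ q`. -/
theorem has_prod_iff [Nonempty M] [Finite α] [Finite β] {κ : Cardinal.{w}} (hM : IsMonster L M κ)
    (p : GlobalType L M α) (q : GlobalType L M β) {A : Set M} (hA : #A < κ)
    (hq : InvariantOver q A) (φ : L.Formula (A ⊕ (α ⊕ β))) {a : α → M} (ha : Realizes p A a) :
    Has (prod hM p q ⟨A, hA, hq⟩) (φ.relabel (Sum.map (fun m : A => (m : M)) id)) ↔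
      Has q (substLeft (φ.relabel (Sum.map (fun m : A => (m : M)) id)) a) := by
  have key : ∀ ψ : L.Formula (A ⊕ (α ⊕ β)),
      ProdHas κ p q (ψ.relabel (Sum.map (fun m : A => (m : M)) id)) →
      Has q (substLeft (ψ.relabel (Sum.map (fun m : A => (m : M)) id)) a) := by
    rintro ψ ⟨D, hD, h⟩
    obtain ⟨a', ha'⟩ := exists_realizes hM.saturated p
      ((mk_union_le D A).trans_lt (add_lt_of_lt hM.aleph0_lt.le hD hA))
    have h' := h a' (ha'.mono Set.subset_union_left)
    have ha'' := ha'.mono (Set.subset_union_right (s := D) (t := A))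
    obtain ⟨k, ⟨e⟩⟩ := Finite.exists_equiv_fin α
    let χ : L.Formula ((A ⊕ Fin k) ⊕ β) := ψ.relabel
      (Sum.elim (fun m => Sum.inl (Sum.inl m))
        (Sum.elim (fun i => Sum.inl (Sum.inr (e i))) Sum.inr))
    have hχ : ∀ d : α → M,
        Has q (substLeft (ψ.relabel (Sum.map (fun m : A => (m : M)) id)) d) ↔
        Has q (χ.relabel (Sum.map (Sum.elim (fun m : A => (m : M)) (d ∘ e.symm)) id)) := by
      intro d
      refine has_congr q fun b => ?_
      simp only [substLeft, χ, Formula.realize_relabel]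
      refine iff_of_eq (congrArg _ ?_)
      ext i
      rcases i with i | i | i <;> simp
    rw [hχ] at h' ⊢
    refine (hq _ _ _ (fun θ => ?_) χ).1 h'
    have hg : ∀ d : α → M, θ.Realize (Sum.elim (fun m : A => (m : M)) (d ∘ e.symm)) ↔
        (θ.relabel (Sum.map id e.symm)).Realize (Sum.elim (fun m : A => (m : M)) d) := by
      intro d
      rw [Formula.realize_relabel]
      refine iff_of_eq (congrArg _ ?_)
      ext i
      rcases i with i | i <;> rfl
    rw [hg, hg, realizes_iff p _ _ ha'', realizes_iff p _ _ ha]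
  have hdef : ∀ ψ : L.Formula (M ⊕ (α ⊕ β)), Has (prod hM p q ⟨A, hA, hq⟩) ψ ↔ ProdHas κ p q ψ := by
    intro ψ
    change ProdHas κ p q (toSentence.symm (toSentence ψ)) ↔ _
    rw [Equiv.symm_apply_apply]
  refine ⟨fun h => key φ ((hdef _).1 h), fun h => ?_⟩
  by_contra hn
  exact (has_not q _).1 (key φ.not ((hdef _).1 ((has_not _ _).2 hn))) h

end Product

end MonsterModel

namespace MonsterModel

universe u v w x y z t

/-! ### Types, invariance and saturation in terms of definable sets. -/

section DefinableSets

variable {L : FirstOrder.Language.{u, v}} {M : Type w} [L.Structure M] {α : Type x} {β : Type y}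
  {γ : Type z}

/-! Generic stability enters through two facts. First, a definable set containing a whole Morley
sequence in `p` over `A` belongs to `p` (`GenericallyStable.mem_of_isMorleySeq`): otherwise a
conjugate of that set splits a Morley sequence of length ω+ω into two infinite halves. Second, `p`
commutes with every invariant type (`GenericallyStable.realizes_swap`).

For weight one (`RegularOver.realizes_or_realizes`), suppose `a` realizes `p` neither over `Ab` nor
over `Ac`. Build copies `(c' n, s n)` of `(c, a)` over `Ab` with `c' n` realizing `r` over `A` and
all earlier `s k`. For `k < n`, commutation makes `s k` generic over `c' n`. Since `s n` is not
generic over `A` and `c' n`, regularity makes `s k` generic over `s n` too, and commuting `p` with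
itself turns this around. So `s` is a Morley sequence in `p` over `A`. But one formula of `p` over
`Ab` fails at `a`, hence at every `s n`, which contradicts the first fact. Of `b` only `c ⊨ r ↾ Ab`
is used, so `b` can be any finite tuple.

For the corollary, weight one brings orthogonality, a statement about all of `M`, down to small sets
(`Orthogonal.realizes`): realizations of `p ↾ A` and `r ↾ A` are automatically independent. Using
this for `q` over `A` and then for `r` over `Ab` fixes the type of `(a, b, c)` over `A`. The
converse direction is projection to the factors. -/

/-- The definable set `S` is defined by a formula of the global type `p`. -/
def Mem (p : GlobalType L M α) (S : Set (α → M)) : Prop :=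
  ∃ φ : L.Formula (M ⊕ α), Has p φ ∧ ∀ a, a ∈ S ↔ φ.Realize (Sum.elim id a)

/-- The fiber over the tuple `c` of a set of tuples. -/
def fiber (T : Set (γ ⊕ α → M)) (c : γ → M) : Set (α → M) :=
  {a | Sum.elim c a ∈ T}

theorem mem_fiber {T : Set (γ ⊕ α → M)} {c : γ → M} {a : α → M} :
    a ∈ fiber T c ↔ Sum.elim c a ∈ T :=
  Iff.rfl

theorem definable_iff_exists {A : Set M} {S : Set (α → M)} :
    A.Definable L S ↔ ∃ φ : L.Formula (A ⊕ α),
      ∀ a, a ∈ S ↔ φ.Realize (Sum.elim (fun m : A => (m : M)) a) := by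
  rw [Set.definable_iff_exists_formula_sum]
  exact exists_congr fun φ => Set.ext_iff

theorem definable_univ_iff_exists {S : Set (α → M)} :
    (Set.univ : Set M).Definable L S ↔ ∃ φ : L.Formula (M ⊕ α),
      ∀ a, a ∈ S ↔ φ.Realize (Sum.elim id a) := by
  rw [definable_iff_exists]
  constructor
  · rintro ⟨φ, h⟩
    refine ⟨φ.relabel (Sum.map Subtype.val id), fun a => (h a).trans ?_⟩
    rw [Formula.realize_relabel]
    exact iff_of_eq (congrArg _ (by ext i; cases i <;> rfl))
  · rintro ⟨φ, h⟩
    refine ⟨φ.relabel (Sum.map (fun m => ⟨m, trivial⟩) id), fun a => (h a).trans ?_⟩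
    rw [Formula.realize_relabel]
    exact iff_of_eq (congrArg _ (by ext i; cases i <;> rfl))

theorem sameType_iff {A : Set M} {b₁ b₂ : α → M} :
    SameType L A b₁ b₂ ↔ ∀ S : Set (α → M), A.Definable L S → (b₁ ∈ S ↔ b₂ ∈ S) := by
  constructor
  · intro h S hS
    obtain ⟨φ, hφ⟩ := definable_iff_exists.1 hS
    rw [hφ, hφ]
    exact h φ
  · intro h φ
    exact h {a | φ.Realize (Sum.elim (fun m : A => (m : M)) a)}
      (definable_iff_exists.2 ⟨φ, fun _ => Iff.rfl⟩)

theorem sameType_of_imp {A : Set M} {b₁ b₂ : α → M}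
    (h : ∀ S : Set (α → M), A.Definable L S → b₁ ∈ S → b₂ ∈ S) : SameType L A b₁ b₂ :=
  sameType_iff.2 fun S hS => ⟨h S hS, fun h₂ => by
    by_contra h₁
    exact h _ hS.compl h₁ h₂⟩

theorem SameType.symm {A : Set M} {b₁ b₂ : α → M} (h : SameType L A b₁ b₂) :
    SameType L A b₂ b₁ := fun φ => (h φ).symm

theorem SameType.mono {A B : Set M} {b₁ b₂ : α → M} (h : SameType L B b₁ b₂) (hAB : A ⊆ B) :
    SameType L A b₁ b₂ :=
  sameType_iff.2 fun S hS => sameType_iff.1 h S (hS.mono hAB)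

theorem SameType.comp {A : Set M} {b₁ b₂ : β → M} (h : SameType L A b₁ b₂) (f : α → β) :
    SameType L A (b₁ ∘ f) (b₂ ∘ f) :=
  sameType_iff.2 fun _ hS => sameType_iff.1 h _ (hS.preimage_comp f)

theorem definable_fiber {A : Set M} {T : Set (γ ⊕ α → M)} (hT : A.Definable L T) (c : γ → M) :
    (A ∪ Set.range c).Definable L (fiber T c) := by
  obtain ⟨φ, hφ⟩ := definable_iff_exists.1 hT
  refine definable_iff_exists.2 ⟨φ.relabel (Sum.elim (fun m : A => Sum.inl ⟨m, Or.inl m.2⟩)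
    (Sum.map (fun i => ⟨c i, Or.inr ⟨i, rfl⟩⟩) id)), fun a => (hφ _).trans ?_⟩
  rw [Formula.realize_relabel]
  exact iff_of_eq (congrArg _ (by ext i; rcases i with i | i | i <;> rfl))

/-- Parameters in the range of `c` are traded for variables, so that the tuple can later be replaced
by a conjugate. -/
theorem exists_eq_fiber {A : Set M} {c : γ → M} {S : Set (α → M)}
    (hS : (A ∪ Set.range c).Definable L S) :
    ∃ T : Set (γ ⊕ α → M), A.Definable L T ∧ S = fiber T c := by
  classical
  obtain ⟨φ, hφ⟩ := definable_iff_exists.1 hS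
  have hg : ∀ m : ↥(A ∪ Set.range c), ∃ s : A ⊕ γ, Sum.elim (fun m : A => (m : M)) c s = m := by
    rintro ⟨m, hm | ⟨i, rfl⟩⟩
    · exact ⟨Sum.inl ⟨m, hm⟩, rfl⟩
    · exact ⟨Sum.inr i, rfl⟩
  choose g hg using hg
  let f : ↥(A ∪ Set.range c) ⊕ α → A ⊕ (γ ⊕ α) := fun s =>
    Equiv.sumAssoc A γ α (Sum.map g id s)
  refine ⟨_, definable_iff_exists.2 ⟨φ.relabel f, fun _ => Iff.rfl⟩, ?_⟩
  ext a
  rw [hφ]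
  change _ ↔ (φ.relabel f).Realize _
  rw [Formula.realize_relabel]
  refine iff_of_eq (congrArg _ ?_)
  ext i
  rcases i with i | i
  · have h := hg i
    simp only [f, Sum.elim_inl, Function.comp_apply, Sum.map_inl]
    rw [← h]
    rcases g i with j | j <;> rfl
  · rfl

theorem definable_univ_fiber {A : Set M} {T : Set (γ ⊕ α → M)} (hT : A.Definable L T)
    (c : γ → M) : (Set.univ : Set M).Definable L (fiber T c) :=
  (definable_fiber hT c).mono (Set.subset_univ _)

theorem exists_eq_fiber_of_definable_univ {S : Set (α → M)}
    (hS : (Set.univ : Set M).Definable L S) :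
    ∃ (n : ℕ) (c : Fin n → M) (T : Set (Fin n ⊕ α → M)),
      (∅ : Set M).Definable L T ∧ S = fiber T c := by
  obtain ⟨A₀, -, hA₀⟩ := Set.definable_iff_finitely_definable.1 hS
  refine ⟨A₀.card, fun i => (A₀.equivFin.symm i : M), ?_⟩
  refine exists_eq_fiber (hA₀.mono fun m hm => Or.inr ⟨A₀.equivFin ⟨m, hm⟩, by simp⟩)

theorem definable_exists [Finite α] [Finite γ] {A : Set M} {T : Set (γ ⊕ α → M)}
    (hT : A.Definable L T) : A.Definable L {c : γ → M | ∃ a : α → M, Sum.elim c a ∈ T} := by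
  convert hT.image_comp (Sum.inl : γ → γ ⊕ α) using 1
  ext c
  constructor
  · rintro ⟨a, ha⟩
    exact ⟨_, ha, rfl⟩
  · rintro ⟨d, hd, rfl⟩
    exact ⟨d ∘ Sum.inr, by rwa [show Sum.elim (d ∘ Sum.inl) (d ∘ Sum.inr) = d from
      Sum.elim_comp_inl_inr d]⟩

/-! ### Membership of definable sets in a global type -/

theorem Mem.definable {p : GlobalType L M α} {S : Set (α → M)} (h : Mem p S) :
    (Set.univ : Set M).Definable L S :=
  let ⟨φ, _, hφ⟩ := h
  definable_univ_iff_exists.2 ⟨φ, hφ⟩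

variable [Finite α]

theorem mem_iff_has {p : GlobalType L M α} {S : Set (α → M)} {φ : L.Formula (M ⊕ α)}
    (hφ : ∀ a, a ∈ S ↔ φ.Realize (Sum.elim id a)) : Mem p S ↔ Has p φ := by
  constructor
  · rintro ⟨ψ, hψ, h⟩
    exact (has_congr p fun a => (h a).symm.trans (hφ a)).1 hψ
  · exact fun h => ⟨φ, h, hφ⟩

theorem mem_compl_iff {p : GlobalType L M α} {S : Set (α → M)}
    (hS : (Set.univ : Set M).Definable L S) : Mem p Sᶜ ↔ ¬ Mem p S := by
  obtain ⟨φ, hφ⟩ := definable_univ_iff_exists.1 hS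
  rw [mem_iff_has hφ, ← has_not p φ]
  exact mem_iff_has fun a => by rw [Formula.realize_not, Set.mem_compl_iff, hφ]

theorem exists_mem_of_forall_mem (p : GlobalType L M α) (F : Set (Set (α → M))) (hF : F.Finite)
    (h : ∀ S ∈ F, Mem p S) : ∃ a : α → M, ∀ S ∈ F, a ∈ S := by
  classical
  choose! φ hφ hφ' using h
  obtain ⟨a, ha⟩ := exists_realize p (hF.toFinset.image φ) (by
    intro ψ hψ
    obtain ⟨S, hS, rfl⟩ := Finset.mem_image.1 hψ
    exact hφ S (hF.mem_toFinset.1 hS))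
  exact ⟨a, fun S hS => (hφ' S hS a).2
    (ha _ (Finset.mem_image_of_mem _ (hF.mem_toFinset.2 hS)))⟩

theorem Mem.nonempty {p : GlobalType L M α} {S : Set (α → M)} (h : Mem p S) : S.Nonempty := by
  obtain ⟨a, ha⟩ := exists_mem_of_forall_mem p {S} (Set.finite_singleton _) (by simpa using h)
  exact ⟨a, ha S rfl⟩

theorem mem_of_inter_subset {p : GlobalType L M α} {S T U : Set (α → M)} (hS : Mem p S)
    (hT : Mem p T) (hU : (Set.univ : Set M).Definable L U) (h : S ∩ T ⊆ U) : Mem p U := by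
  by_contra hn
  obtain ⟨a, ha⟩ := exists_mem_of_forall_mem p {S, T, Uᶜ} (by simp)
    (by simpa [hS, hT] using (mem_compl_iff hU).2 hn)
  exact ha Uᶜ (by simp) (h ⟨ha S (by simp), ha T (by simp)⟩)

theorem Mem.mono {p : GlobalType L M α} {S U : Set (α → M)} (hS : Mem p S)
    (hU : (Set.univ : Set M).Definable L U) (h : S ⊆ U) : Mem p U :=
  mem_of_inter_subset hS hS hU (by simpa using h)

theorem Mem.inter {p : GlobalType L M α} {S T : Set (α → M)} (hS : Mem p S) (hT : Mem p T) :
    Mem p (S ∩ T) :=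
  mem_of_inter_subset hS hT (hS.definable.inter hT.definable) subset_rfl

theorem mem_biInter {p : GlobalType L M α} {ι : Type t} (s : Finset ι) (S : ι → Set (α → M))
    (h : ∀ i ∈ s, Mem p (S i)) : Mem p (⋂ i ∈ s, S i) := by
  classical
  induction s using Finset.induction_on with
  | empty =>
    simp only [Finset.notMem_empty, Set.iInter_of_empty, Set.iInter_univ]
    by_contra hn
    obtain ⟨a, ha⟩ := ((mem_compl_iff Set.definable_univ).2 hn).nonempty
    exact ha trivial
  | insert i s _ ih =>
    rw [Finset.set_biInter_insert]
    exact (h i (Finset.mem_insert_self _ _)).inter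
      (ih fun j hj => h j (Finset.mem_insert_of_mem hj))

theorem realizes_iff_mem {p : GlobalType L M α} {A : Set M} {a : α → M} :
    Realizes p A a ↔ ∀ S : Set (α → M), A.Definable L S → Mem p S → a ∈ S := by
  constructor
  · intro h S hS hpS
    obtain ⟨φ, hφ⟩ := definable_iff_exists.1 hS
    refine (hφ a).2 (h φ ((mem_iff_has fun b => (hφ b).trans ?_).1 hpS))
    rw [Formula.realize_relabel]
    exact iff_of_eq (congrArg _ (by ext i; cases i <;> rfl))
  · intro h φ hφ
    refine h {a | φ.Realize (Sum.elim (fun m : A => (m : M)) a)}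
      (definable_iff_exists.2 ⟨φ, fun _ => Iff.rfl⟩) ((mem_iff_has fun b => ?_).2 hφ)
    change φ.Realize _ ↔ _
    rw [Formula.realize_relabel]
    exact iff_of_eq (congrArg _ (by ext i; cases i <;> rfl))

theorem Realizes.mem_iff {p : GlobalType L M α} {A : Set M} {a : α → M} (h : Realizes p A a)
    {S : Set (α → M)} (hS : A.Definable L S) : a ∈ S ↔ Mem p S := by
  refine ⟨fun ha => ?_, realizes_iff_mem.1 h S hS⟩
  by_contra hn
  exact realizes_iff_mem.1 h _ hS.compl
    ((mem_compl_iff (hS.mono (Set.subset_univ _))).2 hn) ha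

theorem Realizes.sameType {p : GlobalType L M α} {A : Set M} {a₁ a₂ : α → M}
    (h₁ : Realizes p A a₁) (h₂ : Realizes p A a₂) : SameType L A a₁ a₂ :=
  sameType_iff.2 fun _ hS => (h₁.mem_iff hS).trans (h₂.mem_iff hS).symm

theorem Realizes.of_sameType {p : GlobalType L M α} {A : Set M} {a₁ a₂ : α → M}
    (h₁ : Realizes p A a₁) (h : SameType L A a₁ a₂) : Realizes p A a₂ :=
  realizes_iff_mem.2 fun S hS hp => (sameType_iff.1 h S hS).1 ((h₁.mem_iff hS).2 hp)

theorem realizes_union_range_iff {p : GlobalType L M α} {A : Set M} {c : γ → M} {a : α → M} :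
    Realizes p (A ∪ Set.range c) a ↔ ∀ T : Set (γ ⊕ α → M), A.Definable L T →
      Mem p (fiber T c) → Sum.elim c a ∈ T := by
  rw [realizes_iff_mem]
  constructor
  · exact fun h T hT hp => h _ (definable_fiber hT c) hp
  · intro h S hS hp
    obtain ⟨T, hT, rfl⟩ := exists_eq_fiber hS
    exact h T hT hp

theorem Realizes.elim_mem_iff {p : GlobalType L M α} {A : Set M} {c : γ → M} {a : α → M}
    (h : Realizes p (A ∪ Set.range c) a) {T : Set (γ ⊕ α → M)} (hT : A.Definable L T) :
    Sum.elim c a ∈ T ↔ Mem p (fiber T c) :=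
  h.mem_iff (definable_fiber hT c)

theorem InvariantOver.mem_fiber_iff [Finite γ] {p : GlobalType L M α} {A : Set M}
    (hp : InvariantOver p A) {c₁ c₂ : γ → M} (h : SameType L A c₁ c₂) {T : Set (γ ⊕ α → M)}
    (hT : A.Definable L T) : Mem p (fiber T c₁) ↔ Mem p (fiber T c₂) := by
  obtain ⟨n, ⟨e⟩⟩ := Finite.exists_equiv_fin γ
  obtain ⟨φ, hφ⟩ := definable_iff_exists.1 hT
  let ψ : L.Formula ((A ⊕ Fin n) ⊕ α) := φ.relabel
    (Sum.elim (fun m => Sum.inl (Sum.inl m)) (Sum.map (fun i => Sum.inr (e i)) id))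
  have key : ∀ c : γ → M, Mem p (fiber T c) ↔
      Has p (ψ.relabel (Sum.map (Sum.elim (fun m : A => (m : M)) (c ∘ e.symm)) id)) := by
    intro c
    refine mem_iff_has fun a => (hφ _).trans ?_
    simp only [ψ, Formula.realize_relabel]
    exact iff_of_eq (congrArg _ (by ext i; rcases i with i | i | i <;> simp))
  rw [key, key]
  exact hp n _ _ (h.comp e.symm) ψ

/-- A formula over `B` uses finitely many elements of `B`. Appended to the tuples `b₁` and `b₂`,
they leave a formula over `A`, and the longer tuples still have the same type over `A`. -/
theorem InvariantOver.mono {p : GlobalType L M α} {A B : Set M} (hp : InvariantOver p A)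
    (hAB : A ⊆ B) : InvariantOver p B := by
  intro n b₁ b₂ h φ
  have key : ∀ S : Set (Fin n ⊕ α → M), B.Definable L S →
      (Mem p (fiber S b₁) ↔ Mem p (fiber S b₂)) := by
    intro S hS
    obtain ⟨B₀, hB₀, hS⟩ := Set.definable_iff_finitely_definable.1 hS
    obtain ⟨T, hT, rfl⟩ := exists_eq_fiber (A := A) (c := fun m : B₀ => (m : M))
      (hS.mono (by simp))
    let T' : Set ((B₀ ⊕ Fin n) ⊕ α → M) :=
      (fun g => g ∘ (Equiv.sumAssoc B₀ (Fin n) α).symm) ⁻¹' T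
    have hT' : A.Definable L T' := hT.preimage_comp _
    have hfib : ∀ b : Fin n → M, fiber (fiber T fun m : B₀ => (m : M)) b =
        fiber T' (Sum.elim (fun m : B₀ => (m : M)) b) := by
      intro b
      ext a
      refine iff_of_eq (congrArg (· ∈ T) ?_)
      ext i
      rcases i with i | i | i <;> rfl
    rw [hfib, hfib]
    refine hp.mem_fiber_iff (sameType_iff.2 fun U hU => ?_) hT'
    refine sameType_iff.1 h (fiber U _) ((definable_fiber hU _).mono ?_)
    rintro m (hm | ⟨i, rfl⟩)
    exacts [hAB hm, hB₀ i.2]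
  let S : Set (Fin n ⊕ α → M) := {d | (φ.relabel (Equiv.sumAssoc B (Fin n) α)).Realize
    (Sum.elim (fun m : B => (m : M)) d)}
  have hS := key S (definable_iff_exists.2 ⟨_, fun _ => Iff.rfl⟩)
  have hb : ∀ b : Fin n → M, Mem p (fiber S b) ↔
      Has p (φ.relabel (Sum.map (Sum.elim (fun m : B => (m : M)) b) id)) := by
    intro b
    refine mem_iff_has fun a => ?_
    change (φ.relabel _).Realize _ ↔ _
    simp only [Formula.realize_relabel]
    exact iff_of_eq (congrArg _ (by ext i; rcases i with (i | i) | i <;> rfl))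
  rwa [hb, hb] at hS

/-- By invariance, which fibers lie in `p` depends only on the type over `A` of the tuple defining
them. -/
theorem Realizes.sameType_elim [Finite γ] {p : GlobalType L M α} {A : Set M}
    (hp : InvariantOver p A) {c₁ c₂ : γ → M} {a₁ a₂ : α → M} (hc : SameType L A c₁ c₂)
    (h₁ : Realizes p (A ∪ Set.range c₁) a₁) (h₂ : Realizes p (A ∪ Set.range c₂) a₂) :
    SameType L A (Sum.elim c₁ a₁) (Sum.elim c₂ a₂) :=
  sameType_iff.2 fun _ hT => ((h₁.elim_mem_iff hT).trans (hp.mem_fiber_iff hc hT)).trans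
    (h₂.elim_mem_iff hT).symm

theorem Realizes.of_sameType_elim [Finite γ] {p : GlobalType L M α} {A : Set M}
    (hp : InvariantOver p A) {c₁ c₂ : γ → M} {a₁ a₂ : α → M}
    (h₁ : Realizes p (A ∪ Set.range c₁) a₁)
    (h : SameType L A (Sum.elim c₁ a₁) (Sum.elim c₂ a₂)) :
    Realizes p (A ∪ Set.range c₂) a₂ := by
  refine realizes_union_range_iff.2 fun T hT hT₂ => ?_
  have hc : SameType L A c₁ c₂ := h.comp Sum.inl
  exact (sameType_iff.1 h T hT).1 ((h₁.elim_mem_iff hT).2 ((hp.mem_fiber_iff hc hT).2 hT₂))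

/-! ### Saturation -/

theorem small_union_small {κ : Cardinal.{w}} (hκ : ℵ₀ < κ) {A B : Set M} (hA : #A < κ)
    (hB : #B < κ) : #↥(A ∪ B) < κ :=
  (mk_union_le A B).trans_lt (add_lt_of_lt hκ.le hA hB)

theorem small_range {κ : Cardinal.{w}} (hκ : ℵ₀ < κ) {ι : Type y} [Countable ι] (c : ι → M) :
    #(Set.range c) < κ :=
  (mk_le_aleph0_iff.2 (Set.countable_range c).to_subtype).trans_lt hκ

/-- Saturation restated for families of definable sets and an arbitrary finite set of variables. -/
theorem IsSaturated.exists_mem {κ : Cardinal.{w}} (hM : IsSaturated L M κ) {A : Set M}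
    (hA : #A < κ) (F : Set (Set (α → M))) (hF : ∀ S ∈ F, A.Definable L S)
    (h : ∀ F₀ ⊆ F, F₀.Finite → ∃ a : α → M, ∀ S ∈ F₀, a ∈ S) :
    ∃ a : α → M, ∀ S ∈ F, a ∈ S := by
  classical
  obtain ⟨n, ⟨e⟩⟩ := Finite.exists_equiv_fin α
  let D : L.Formula (A ⊕ Fin n) → Set (α → M) := fun φ =>
    {a | φ.Realize (Sum.elim (fun m : A => (m : M)) (a ∘ e.symm))}
  obtain ⟨a, ha⟩ := hM A hA n {φ | D φ ∈ F} (by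
    intro Φ₀ hΦ
    obtain ⟨a, ha⟩ := h (D '' Φ₀) (by rintro _ ⟨φ, hφ, rfl⟩; exact hΦ hφ)
      (Φ₀.finite_toSet.image _)
    exact ⟨a ∘ e.symm, fun φ hφ => ha (D φ) ⟨φ, hφ, rfl⟩⟩)
  refine ⟨a ∘ e, fun S hS => ?_⟩
  obtain ⟨φ, hφ⟩ := definable_iff_exists.1 (hF S hS)
  have hD : D (φ.relabel (Sum.map id e)) = S := by
    ext b
    rw [hφ]
    change (φ.relabel _).Realize _ ↔ _
    rw [Formula.realize_relabel]
    exact iff_of_eq (congrArg _ (by ext i; cases i <;> simp))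
  rw [← hD]
  change (φ.relabel _).Realize _
  have h' := ha (φ.relabel (Sum.map id e)) (by change D _ ∈ F; rwa [hD])
  rw [show (a ∘ e) ∘ e.symm = a by ext i; simp]
  exact h'

/-- In a monster model, tuples of the same type can be extended to tuples of the same type. -/
theorem IsMonster.exists_sameType [Finite γ] {κ : Cardinal.{w}} (hM : IsMonster L M κ) {A : Set M}
    (hA : #A < κ) {c₁ c₂ : γ → M} (h : SameType L A c₁ c₂) (a₁ : α → M) :
    ∃ a₂ : α → M, SameType L A (Sum.elim c₁ a₁) (Sum.elim c₂ a₂) := by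
  classical
  obtain ⟨a₂, ha₂⟩ := hM.saturated.exists_mem
    (small_union_small hM.aleph0_lt hA (small_range hM.aleph0_lt c₂))
    {S | ∃ T : Set (γ ⊕ α → M), A.Definable L T ∧ Sum.elim c₁ a₁ ∈ T ∧ S = fiber T c₂}
    (by rintro _ ⟨T, hT, -, rfl⟩; exact definable_fiber hT c₂) (by
      intro F₀ hF₀ hfin
      have hF₁ : ∀ S ∈ F₀, ∃ T : Set (γ ⊕ α → M), A.Definable L T ∧ Sum.elim c₁ a₁ ∈ T ∧
        S = fiber T c₂ := fun S hS => hF₀ hS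
      choose! T hT hT₁ hT₂ using hF₁
      let U : Set (γ ⊕ α → M) := ⋂ S : F₀, T S
      have := hfin.to_subtype
      have hU : A.Definable L U := Set.definable_iInter_of_finite fun S => hT S S.2
      -- Solvability of the finitely many conditions is itself part of the type of `c₁` over `A`, so
      -- it passes to `c₂`.
      have hex := definable_exists hU
      obtain ⟨a, ha⟩ := (sameType_iff.1 h _ hex).1
        ⟨a₁, Set.mem_iInter.2 fun S => hT₁ S S.2⟩
      refine ⟨a, fun S hS => ?_⟩
      rw [hT₂ S hS]
      exact Set.mem_iInter.1 ha ⟨S, hS⟩)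
  exact ⟨a₂, sameType_of_imp fun T hT h₁ => ha₂ _ ⟨T, hT, h₁, rfl⟩⟩

end DefinableSets

/-! ### Morley sequences, commutation and weight one. -/

section Sequences

variable {L : FirstOrder.Language.{u, v}} {M : Type w} [L.Structure M] {α : Type x} {β : Type y}
  {γ : Type z}

/-- Recursive choice in which each term may depend on the finite set of its predecessors. -/
theorem exists_seq_of_finite_image {X : Type t} (R : Set X → X → Prop)
    (h : ∀ s : Set X, s.Finite → ∃ x, R s x) : ∃ f : ℕ → X, ∀ n, R (f '' Set.Iio n) (f n) := by
  have : Nonempty X := ⟨(h ∅ Set.finite_empty).choose⟩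
  choose! g hg using h
  let f : ℕ → X := (wellFounded_lt (α := ℕ)).fix fun n F =>
    g (Set.range fun i : Set.Iio n => F i i.2)
  have hf : ∀ n, f n = g (f '' Set.Iio n) := by
    intro n
    rw [Set.image_eq_range]
    exact WellFounded.fix_eq _ _ n
  refine ⟨f, fun n => ?_⟩
  rw [hf n]
  exact hg _ ((Set.finite_Iio n).image f)

/-- The set of entries of the tuples `a j`, for `j < n`. -/
def entriesBefore (a : ℕ → α → M) (n : ℕ) : Set M :=
  ⋃ j < n, Set.range (a j)

theorem range_subset_entriesBefore (a : ℕ → α → M) {j n : ℕ} (h : j < n) :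
    Set.range (a j) ⊆ entriesBefore a n :=
  Set.subset_biUnion_of_mem (u := fun j => Set.range (a j)) h

theorem entriesBefore_mono (a : ℕ → α → M) {m n : ℕ} (h : m ≤ n) :
    entriesBefore a m ⊆ entriesBefore a n :=
  Set.iUnion₂_subset fun _ hj => range_subset_entriesBefore a (hj.trans_le h)

theorem entriesBefore_succ_subset (a : ℕ → α → M) (n : ℕ) :
    entriesBefore a (n + 1) ⊆ entriesBefore a n ∪ Set.range (a n) := by
  refine Set.iUnion₂_subset fun j hj => ?_
  rcases Nat.lt_succ_iff_lt_or_eq.1 hj with hj | rfl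
  · exact (range_subset_entriesBefore a hj).trans Set.subset_union_left
  · exact Set.subset_union_right

theorem entriesBefore_zero (a : ℕ → α → M) : entriesBefore a 0 = ∅ := by
  simp [entriesBefore]

theorem entriesBefore_eq_range (a : ℕ → α → M) (n : ℕ) :
    entriesBefore a n = Set.range fun i : Fin n × α => a i.1 i.2 := by
  ext m
  simp only [entriesBefore, Set.mem_iUnion, Set.mem_range, Prod.exists]
  constructor
  · rintro ⟨j, hj, i, rfl⟩
    exact ⟨⟨j, hj⟩, i, rfl⟩
  · rintro ⟨j, i, rfl⟩
    exact ⟨j, j.2, i, rfl⟩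

/-- `(a i | i < ω)` is a Morley sequence in `p` over `A`. -/
def IsMorleySeq (p : GlobalType L M α) (A : Set M) (a : ℕ → α → M) : Prop :=
  ∀ n, Realizes p (A ∪ entriesBefore a n) (a n)

variable [Finite α]

theorem small_entriesBefore {κ : Cardinal.{w}} (hκ : ℵ₀ < κ) (a : ℕ → α → M) (n : ℕ) :
    #(entriesBefore a n) < κ := by
  rw [entriesBefore_eq_range]
  exact small_range hκ _

theorem small_iUnion_range {κ : Cardinal.{w}} (hκ : ℵ₀ < κ) (a : ℕ → α → M) :
    #↥(⋃ n, Set.range (a n)) < κ :=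
  (mk_le_aleph0_iff.2 (Set.countable_iUnion fun n => Set.countable_range (a n)).to_subtype).trans_lt
    hκ

theorem IsMorleySeq.realizes {p : GlobalType L M α} {A : Set M} {a : ℕ → α → M}
    (h : IsMorleySeq p A a) (n : ℕ) : Realizes p A (a n) :=
  (h n).mono Set.subset_union_left

theorem IsMorleySeq.mono {p : GlobalType L M α} {A B : Set M} {a : ℕ → α → M}
    (h : IsMorleySeq p B a) (hAB : A ⊆ B) : IsMorleySeq p A a :=
  fun n => (h n).mono (Set.union_subset_union_left _ hAB)

theorem exists_isMorleySeq {κ : Cardinal.{w}} (hM : IsMonster L M κ) (p : GlobalType L M α)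
    {A : Set M} (hA : #A < κ) : ∃ a : ℕ → α → M, IsMorleySeq p A a := by
  obtain ⟨a, ha⟩ := exists_seq_of_finite_image
    (fun (s : Set (α → M)) x => Realizes p (A ∪ ⋃ y ∈ s, Set.range y) x) fun s hs =>
      exists_realizes hM.saturated p (small_union hM.aleph0_lt hA
        (hs.biUnion fun y _ => Set.finite_range y))
  refine ⟨a, fun n => ?_⟩
  have h := ha n
  rw [Set.biUnion_image] at h
  exact h

/-- Induction on the length: invariance determines the type of each new term together with its
predecessors. -/
theorem IsMorleySeq.sameType {p : GlobalType L M α} {A : Set M} (hp : InvariantOver p A)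
    {a a' : ℕ → α → M} (h : IsMorleySeq p A a) (h' : IsMorleySeq p A a') (n : ℕ) :
    SameType L A (fun i : Fin n × α => a i.1 i.2) (fun i : Fin n × α => a' i.1 i.2) := by
  induction n with
  | zero =>
    rw [show (fun i : Fin 0 × α => a i.1 i.2) = fun i : Fin 0 × α => a' i.1 i.2 from
      funext fun i => i.1.elim0]
    exact fun φ => Iff.rfl
  | succ n ih =>
    have h₁ := h n
    have h₂ := h' n
    rw [entriesBefore_eq_range] at h₁ h₂
    let f : Fin (n + 1) × α → (Fin n × α) ⊕ α := fun i =>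
      if hi : (i.1 : ℕ) < n then Sum.inl (⟨i.1, hi⟩, i.2) else Sum.inr i.2
    have hf : ∀ a : ℕ → α → M, (fun i : Fin (n + 1) × α => a i.1 i.2) =
        Sum.elim (fun i : Fin n × α => a i.1 i.2) (a n) ∘ f := by
      intro a
      ext ⟨i, j⟩
      by_cases hi : (i : ℕ) < n
      · simp [f, hi]
      · simp only [f, hi, Function.comp_apply, dite_false, Sum.elim_inr]
        rw [show (i : ℕ) = n by omega]
    rw [hf, hf]
    exact (Realizes.sameType_elim hp ih h₁ h₂).comp f

/-- A definable set containing a Morley sequence in a generically stable type, over any set over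
which the type is invariant, belongs to the type. -/
theorem GenericallyStable.mem_of_isMorleySeq {κ : Cardinal.{w}} (hM : IsMonster L M κ)
    {p : GlobalType L M α} (hp : GenericallyStable κ p) {A : Set M} (hA : #A < κ)
    (hpA : InvariantOver p A) {a : ℕ → α → M} (ha : IsMorleySeq p A a) {S : Set (α → M)}
    (hS : (Set.univ : Set M).Definable L S) (haS : ∀ n, a n ∈ S) : Mem p S := by
  by_contra hn
  obtain ⟨m, d, T, hT, rfl⟩ := exists_eq_fiber_of_definable_univ hS
  obtain ⟨-, A₀, hA₀, -, hstab⟩ := hp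
  -- Stability of Morley sequences is known only over `A₀`, while `a` is Morley over `A`. A sequence
  -- over the union serves both purposes: it has the type of `a` over `A`, so `d` can be moved to a
  -- tuple `d'` playing the same role for `a'`.
  obtain ⟨a', ha'⟩ := exists_isMorleySeq hM p (small_union_small hM.aleph0_lt hA hA₀)
  have hd : ∃ d' : Fin m → M, SameType L A d d' ∧ ∀ n, a' n ∈ fiber T d' := by
    let G : ℕ → Set (Fin m → M) := fun n => {d' | a' n ∈ fiber T d'}
    obtain ⟨d', hd'⟩ := hM.saturated.exists_mem
      (small_union_small hM.aleph0_lt hA (small_iUnion_range hM.aleph0_lt a'))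
      ({S | A.Definable L S ∧ d ∈ S} ∪ Set.range G) (by
        rintro S (⟨hS, -⟩ | ⟨n, rfl⟩)
        · exact hS.mono Set.subset_union_left
        · have h := definable_fiber ((hT.mono (Set.empty_subset A)).preimage_comp Sum.swap) (a' n)
          convert h.mono (Set.union_subset_union_right A
            (Set.subset_iUnion (fun n => Set.range (a' n)) n)) using 1
          ext d'
          refine iff_of_eq (congrArg (· ∈ T) ?_)
          ext i
          cases i <;> rfl) (by
        intro F₀ hF₀ hfin
        have hidx : ∀ S ∈ F₀, ∃ n, S ∈ Set.range G → S = G n := by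
          intro S _
          by_cases h : S ∈ Set.range G
          · obtain ⟨n, rfl⟩ := h
            exact ⟨n, fun _ => rfl⟩
          · exact ⟨0, fun h' => absurd h' h⟩
        choose! k hk using hidx
        -- Finitely many conditions mention only terms up to index `N`, and there the sequences `a`
        -- and `a'` have the same type over `A`.
        obtain ⟨N, hN⟩ := (hfin.image k).bddAbove
        obtain ⟨d', hd'⟩ := hM.exists_sameType hA
          (ha.sameType hpA (ha'.mono Set.subset_union_left) (N + 1)) d
        refine ⟨d', fun S hS => ?_⟩
        rcases hF₀ hS with ⟨hSA, hdS⟩ | hSG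
        · exact (sameType_iff.1 (hd'.comp Sum.inr) S hSA).1 hdS
        · rw [hk S hS hSG]
          have hlt : k S < N + 1 := Nat.lt_succ_of_le (hN ⟨S, hS, rfl⟩)
          let f : Fin m ⊕ α → (Fin (N + 1) × α) ⊕ Fin m :=
            Sum.elim Sum.inr fun i => Sum.inl (⟨k S, hlt⟩, i)
          have h := (sameType_iff.1 (hd'.comp f) T (hT.mono (Set.empty_subset A))).1 (by
            convert haS (k S) using 1
            rw [mem_fiber]
            refine iff_of_eq (congrArg (· ∈ T) ?_)
            ext i
            cases i <;> rfl)
          change Sum.elim d' (a' (k S)) ∈ T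
          convert h using 1
          ext i
          cases i <;> rfl)
    refine ⟨d', sameType_of_imp fun S hS hdS => hd' S (Or.inl ⟨hS, hdS⟩), fun n => ?_⟩
    exact hd' _ (Or.inr ⟨n, rfl⟩)
  obtain ⟨d', hdd', hd'⟩ := hd
  have hn' : ¬ Mem p (fiber T d') := fun h =>
    hn ((hpA.mem_fiber_iff hdd' (hT.mono (Set.empty_subset A))).2 h)
  -- Adding `a'` to the base makes `e` continue `a'` as a Morley sequence; adding `d'` forces every
  -- `e n` out of the fiber, which is not in `p`.
  obtain ⟨e, he⟩ := exists_isMorleySeq hM p (A := A₀ ∪ (⋃ n, Set.range (a' n)) ∪ Set.range d')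
    (small_union_small hM.aleph0_lt
      (small_union_small hM.aleph0_lt hA₀ (small_iUnion_range hM.aleph0_lt a'))
      (small_range hM.aleph0_lt d'))
  have hed : ∀ n, e n ∉ fiber T d' := fun n h =>
    hn' (((he.realizes n).elim_mem_iff (hT.mono (Set.empty_subset _))).1 h)
  -- The concatenation has order type ω+ω; the first half lies in the fiber and the second half
  -- outside it.
  let s : ULift.{w} (ℕ ⊕ₗ ℕ) → α → M := fun i => Sum.elim a' e (ofLex i.down)
  have hs : IsMorley p A₀ s := by
    rintro ⟨i⟩
    obtain ⟨n | n, rfl⟩ := toLex.surjective i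
    · refine (ha' n).mono (Set.union_subset_union Set.subset_union_right ?_)
      refine Set.iUnion_subset ?_
      rintro ⟨⟨j⟩, hj⟩
      obtain ⟨j | j, rfl⟩ := toLex.surjective j
      · exact range_subset_entriesBefore a' (Sum.Lex.inl_lt_inl_iff.1 hj)
      · exact absurd hj (Sum.Lex.not_inr_lt_inl)
    · refine (he n).mono (Set.union_subset (fun m hm => Or.inl (Or.inl (Or.inl hm))) ?_)
      refine Set.iUnion_subset ?_
      rintro ⟨⟨j⟩, hj⟩
      obtain ⟨j | j, rfl⟩ := toLex.surjective j
      · exact fun m hm => Or.inl (Or.inl (Or.inr (Set.mem_iUnion.2 ⟨j, hm⟩)))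
      · exact (range_subset_entriesBefore e (Sum.Lex.inr_lt_inr_iff.1 hj)).trans
          Set.subset_union_right
  obtain ⟨φ, hφ⟩ := definable_univ_iff_exists.1 (definable_univ_fiber hT d')
  have hwf : WellFoundedLT (ULift.{w} (ℕ ⊕ₗ ℕ)) :=
    ⟨InvImage.wf (fun i : ULift.{w} (ℕ ⊕ₗ ℕ) => ofLex i.down)
      (Sum.lex_wf (wellFounded_lt (α := ℕ)) (wellFounded_lt (α := ℕ)))⟩
  have : Infinite (ℕ ⊕ₗ ℕ) := toLex.infinite_iff.1 inferInstance
  have : Countable (ℕ ⊕ₗ ℕ) := toLex.symm.injective.countable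
  have hinj₁ : Function.Injective fun n : ℕ => ULift.up.{w} (Sum.inlₗ n : ℕ ⊕ₗ ℕ) := by
    intro i j hij
    simpa using hij
  have hinj₂ : Function.Injective fun n : ℕ => ULift.up.{w} (Sum.inrₗ n : ℕ ⊕ₗ ℕ) := by
    intro i j hij
    simpa using hij
  rcases hstab (ULift.{w} (ℕ ⊕ₗ ℕ)) ((mk_le_aleph0_iff.2 inferInstance).trans_lt hM.aleph0_lt)
    s hs φ with hfin | hfin
  · exact Set.infinite_of_injective_forall_mem hinj₁ (fun n => (hφ (a' n)).1 (hd' n)) hfin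
  · refine Set.infinite_of_injective_forall_mem hinj₂ (fun n => ?_) hfin
    exact fun h => hed n ((hφ (e n)).2 h)

/-- A generically stable type commutes with invariant types. -/
theorem GenericallyStable.realizes_swap [Finite γ] {κ : Cardinal.{w}} (hM : IsMonster L M κ)
    {p : GlobalType L M α} (hp : GenericallyStable κ p) {r : GlobalType L M γ} {A : Set M}
    (hA : #A < κ) (hpA : InvariantOver p A) (hrA : InvariantOver r A) {a : α → M} {c : γ → M}
    (ha : Realizes p A a) (hc : Realizes r (A ∪ Set.range a) c) :
    Realizes p (A ∪ Set.range c) a := by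
  refine realizes_union_range_iff.2 fun T hT hpT => ?_
  by_contra hn
  have hT' : A.Definable L ((fun g : α ⊕ γ → M => g ∘ Sum.swap) ⁻¹' Tᶜ) :=
    hT.compl.preimage_comp Sum.swap
  have hswap : ∀ (a : α → M) (c : γ → M),
      Sum.elim a c ∈ (fun g : α ⊕ γ → M => g ∘ Sum.swap) ⁻¹' Tᶜ ↔ Sum.elim c a ∉ T := by
    intro a c
    rw [Set.mem_preimage, Set.mem_compl_iff,
      show Sum.elim a c ∘ Sum.swap = Sum.elim c a by ext i; cases i <;> rfl]
  have hrT := (hc.elim_mem_iff hT').1 ((hswap a c).2 hn)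
  -- A single `c'` generic over a whole Morley sequence repeats the failure of `T` at every term, so
  -- the complement of its fiber lies in `p`; but `c'` and `c` have the same type over `A`.
  obtain ⟨s, hs⟩ := exists_isMorleySeq hM p hA
  obtain ⟨c', hc'⟩ := exists_realizes hM.saturated r
    (small_union_small hM.aleph0_lt hA (small_iUnion_range hM.aleph0_lt s))
  have hsc : ∀ n, s n ∈ (fiber T c')ᶜ := by
    intro n
    have h := (hrA.mem_fiber_iff (ha.sameType (hs.realizes n)) hT').1 hrT
    have hc'' := hc'.mono (Set.union_subset_union_right A
      (Set.subset_iUnion (fun n => Set.range (s n)) n))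
    exact (hswap _ _).1 ((hc''.elim_mem_iff hT').2 h)
  have hcc : SameType L A c c' :=
    (hc.mono Set.subset_union_left).sameType (hc'.mono Set.subset_union_left)
  have h := hp.mem_of_isMorleySeq hM hA hpA hs (definable_univ_fiber hT c').compl hsc
  exact (mem_compl_iff (definable_univ_fiber hT c')).1 h ((hpA.mem_fiber_iff hcc hT).1 hpT)

/-- Generically stable regular types have weight one. -/
theorem RegularOver.realizes_or_realizes [Finite β] [Finite γ] {κ : Cardinal.{w}}
    (hM : IsMonster L M κ) {p : GlobalType L M α} (hp : GenericallyStable κ p)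
    {r : GlobalType L M γ} {A : Set M} (hA : #A < κ) (hreg : RegularOver κ p A)
    (hrA : InvariantOver r A) {a : α → M} {b : β → M} {c : γ → M}
    (hc : Realizes r (A ∪ Set.range b) c) (ha : Realizes p A a) :
    Realizes p (A ∪ Set.range b) a ∨ Realizes p (A ∪ Set.range c) a := by
  by_contra hnn
  obtain ⟨hnb, hnc⟩ := not_or.1 hnn
  obtain ⟨-, hpA, hreg⟩ := hreg
  have hκ := hM.aleph0_lt
  obtain ⟨s, hs⟩ := exists_seq_of_finite_image
    (fun (F : Set (α → M)) x => ∃ c' : γ → M, Realizes r (A ∪ ⋃ y ∈ F, Set.range y) c' ∧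
      SameType L A (Sum.elim (Sum.elim b c) a) (Sum.elim (Sum.elim b c') x)) (by
    intro F hF
    -- Choosing `c'` generic over `b` as well gives `(b, c')` the type of `(b, c)` over `A`, so `a`
    -- has a counterpart `x` with the same `b`.
    obtain ⟨c', hc'⟩ := exists_realizes hM.saturated r (small_union_small hκ
      (small_union hκ hA (hF.biUnion fun y _ => Set.finite_range y)) (small_range hκ b))
    obtain ⟨x, hx⟩ := hM.exists_sameType hA (Realizes.sameType_elim hrA
      (fun φ => Iff.rfl) hc (hc'.mono (Set.union_subset_union_left _ Set.subset_union_left))) a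
    exact ⟨x, c', hc'.mono Set.subset_union_left, hx⟩)
  choose c' hc' hsc using hs
  have hc'' : ∀ n, Realizes r (A ∪ entriesBefore s n) (c' n) := by
    intro n
    have h := hc' n
    rw [Set.biUnion_image] at h
    exact h
  have hsA : ∀ n, Realizes p A (s n) := fun n => ha.of_sameType ((hsc n).comp Sum.inr)
  have hsn : ∀ n, ¬ Realizes p (A ∪ Set.range (c' n)) (s n) := by
    intro n h
    refine hnc (h.of_sameType_elim hpA ?_)
    convert ((hsc n).comp (Sum.elim (fun i => Sum.inl (Sum.inr i)) Sum.inr :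
      γ ⊕ α → (β ⊕ γ) ⊕ α)).symm using 1 <;> (ext i; cases i <;> rfl)
  have hmorley : IsMorleySeq p A s := by
    intro n
    induction n using Nat.strong_induction_on with
    | _ n ih =>
    have hk : ∀ k < n, Realizes p (A ∪ entriesBefore s k ∪ Set.range (s n)) (s k) := by
      intro k hkn
      have hAk := small_union_small hκ hA (small_entriesBefore hκ s k)
      have h := hp.realizes_swap hM hAk (hpA.mono Set.subset_union_left)
        (hrA.mono Set.subset_union_left) (ih k hkn) ((hc'' n).mono (by
          rw [Set.union_assoc]
          exact Set.union_subset_union_right A (Set.union_subset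
            (entriesBefore_mono s hkn.le) (range_subset_entriesBefore s hkn))))
      -- Regularity over `A`, `s_{<k}` and `c' n`: the tuple `s n` is not generic there, so
      -- genericity of `s k` extends over `s n`.
      have h' := (hreg _ (small_union_small hκ hAk (small_range hκ (c' n)))
        (Set.subset_union_left.trans Set.subset_union_left) (s n) (hsA n)).resolve_left
        (fun h => hsn n (h.mono (Set.union_subset_union_left _ Set.subset_union_left))) _ h
      exact h'.mono (Set.union_subset_union_left _ Set.subset_union_left)
    have hle : ∀ k ≤ n, Realizes p (A ∪ entriesBefore s k) (s n) := by
      intro k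
      induction k with
      | zero =>
        intro _
        rw [entriesBefore_zero, Set.union_empty]
        exact hsA n
      | succ k ihk =>
        intro hkn
        -- Here `p` commutes with itself: `s k` is generic over `s n`, hence `s n` is generic over
        -- `s k`.
        have h := hp.realizes_swap hM (small_union_small hκ hA (small_entriesBefore hκ s k))
          (hpA.mono Set.subset_union_left) (hpA.mono Set.subset_union_left)
          (ihk (Nat.le_of_succ_le hkn)) (hk k hkn)
        refine h.mono ?_
        rw [Set.union_assoc]
        exact Set.union_subset_union_right A (entriesBefore_succ_subset s k)
    exact hle n le_rfl
  rw [realizes_union_range_iff] at hnb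
  push Not at hnb
  obtain ⟨T, hT, hpT, haT⟩ := hnb
  have h := hp.mem_of_isMorleySeq hM hA hpA hmorley (definable_univ_fiber hT b).compl (by
    intro n hn
    let f : β ⊕ α → (β ⊕ γ) ⊕ α := Sum.elim (fun i => Sum.inl (Sum.inl i)) Sum.inr
    refine haT ?_
    have h := (sameType_iff.1 ((hsc n).comp f) T hT).2 (by
      convert mem_fiber.1 hn using 1
      ext i
      cases i <;> rfl)
    convert h using 1
    ext i
    cases i <;> rfl)
  exact (mem_compl_iff (definable_univ_fiber hT b)).1 h hpT

end Sequences

/-! ### Completions of pairs of types, products and the corollary. -/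

section Orthogonality

variable {L : FirstOrder.Language.{u, v}} {M : Type w} [L.Structure M] {α : Type x} {β : Type y}
  {γ : Type z}

/-- A family of definable sets with the finite intersection property is contained in a global
type. -/
theorem exists_globalType [Nonempty M] (F : Set (Set (α → M)))
    (hF : ∀ S ∈ F, (Set.univ : Set M).Definable L S)
    (h : ∀ F₀ ⊆ F, F₀.Finite → ∃ a : α → M, ∀ S ∈ F₀, a ∈ S) :
    ∃ p : GlobalType L M α, ∀ S ∈ F, Mem p S := by
  classical
  let D : L[[M]][[α]].Sentence → Set (α → M) := fun σ =>
    {a | (toSentence.symm σ).Realize (Sum.elim id a)}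
  have hD : ∀ (a : α → M) σ, a ∈ D σ → σ ∈ (L.elementaryDiagram M).typeOf a := by
    intro a σ ha
    have h := (has_typeOf a (toSentence.symm σ)).2 ha
    rwa [Equiv.apply_symm_apply] at h
  have hne : {p : GlobalType L M α | {σ | D σ ∈ F} ⊆ (p : L[[M]][[α]].Theory)}.Nonempty := by
    rw [Set.nonempty_iff_ne_empty, Ne, Theory.CompleteType.setOfPred_subset_eq_empty_iff, not_not,
      Theory.isSatisfiable_iff_isFinitelySatisfiable]
    intro T₀ hT₀
    obtain ⟨a, ha⟩ := h (D '' {σ | σ ∈ T₀ ∧ D σ ∈ F}) (by rintro _ ⟨σ, hσ, rfl⟩; exact hσ.2)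
      ((T₀.finite_toSet.subset fun σ hσ => hσ.1).image D)
    refine ((L.elementaryDiagram M).typeOf a).isMaximal.1.mono fun σ hσ => ?_
    rcases hT₀ hσ with hσ' | hσ'
    · exact ((L.elementaryDiagram M).typeOf a).subset hσ'
    · exact hD a σ (ha _ ⟨σ, ⟨hσ, hσ'⟩, rfl⟩)
  obtain ⟨p, hp⟩ := hne
  refine ⟨p, fun S hS => ?_⟩
  obtain ⟨φ, hφ⟩ := definable_univ_iff_exists.1 (hF S hS)
  refine ⟨φ, hp ?_, hφ⟩
  change D _ ∈ F
  convert hS using 1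
  ext a
  rw [hφ]
  change (toSentence.symm (toSentence φ)).Realize _ ↔ _
  rw [Equiv.symm_apply_apply]

theorem forall_mem_comp_iff {δ : Type t} [Finite δ] {p : GlobalType L M α}
    {s : GlobalType L M δ} {f : α → δ} :
    (∀ S, Mem p S → Mem s ((fun d : δ → M => d ∘ f) ⁻¹' S)) ↔
      ∀ φ : L.Formula (M ⊕ α), Has p φ → Has s (φ.relabel (Sum.map id f)) := by
  have key : ∀ (S : Set (α → M)) (φ : L.Formula (M ⊕ α)),
      (∀ a, a ∈ S ↔ φ.Realize (Sum.elim id a)) →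
      (Mem s ((fun d : δ → M => d ∘ f) ⁻¹' S) ↔ Has s (φ.relabel (Sum.map id f))) := by
    intro S φ hφ
    refine mem_iff_has fun d => ?_
    rw [Set.mem_preimage, hφ, Formula.realize_relabel]
    exact iff_of_eq (congrArg _ (by ext i; cases i <;> rfl))
  constructor
  · intro h φ hφ
    exact (key {a | φ.Realize (Sum.elim id a)} φ fun _ => Iff.rfl).1
      (h _ ⟨φ, hφ, fun _ => Iff.rfl⟩)
  · rintro h S ⟨φ, hφ, hS⟩
    exact (key S φ hS).2 (h φ hφ)

variable [Finite α] [Finite β] [Finite γ]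

theorem mem_univ (p : GlobalType L M α) : Mem p Set.univ := by
  simpa using mem_biInter (p := p) (∅ : Finset ℕ) (fun _ => Set.univ) (by simp)

theorem eq_of_mem_imp {p q : GlobalType L M α} (h : ∀ S, Mem p S → Mem q S) : p = q := by
  have key : ∀ φ, Has p φ → Has q φ := fun φ hφ =>
    (mem_iff_has (S := {a | φ.Realize (Sum.elim id a)}) fun _ => Iff.rfl).1
      (h _ ⟨φ, hφ, fun _ => Iff.rfl⟩)
  refine SetLike.ext fun σ => ?_
  obtain ⟨φ, rfl⟩ := toSentence.surjective σ
  refine ⟨key φ, fun hq => ?_⟩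
  by_contra hp
  exact (has_not q φ).1 (key _ ((has_not p φ).2 hp)) hq

/-- The global type `s(x, y)` extends `p(x) ∪ q(y)`. -/
def IsCompletion (p : GlobalType L M α) (q : GlobalType L M β) (s : GlobalType L M (α ⊕ β)) :
    Prop :=
  (∀ S, Mem p S → Mem s ((fun d : α ⊕ β → M => d ∘ Sum.inl) ⁻¹' S)) ∧
    ∀ S, Mem q S → Mem s ((fun d : α ⊕ β → M => d ∘ Sum.inr) ⁻¹' S)

theorem orthogonal_iff_existsUnique {p : GlobalType L M α} {q : GlobalType L M β} :
    Orthogonal p q ↔ ∃! s, IsCompletion p q s := by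
  unfold Orthogonal IsCompletion
  simp only [forall_mem_comp_iff]

/-- Compactness: finitely many members of `p`, and of `q`, may be replaced by their intersection. -/
theorem exists_isCompletion_mem [Nonempty M] {p : GlobalType L M α} {q : GlobalType L M β}
    {S : Set (α ⊕ β → M)} (hS : (Set.univ : Set M).Definable L S)
    (h : ∀ P Q, Mem p P → Mem q Q → ∃ a ∈ P, ∃ b ∈ Q, Sum.elim a b ∈ S) :
    ∃ s, IsCompletion p q s ∧ Mem s S := by
  obtain ⟨s, hs⟩ := exists_globalType (L := L)
    (({U | ∃ P, Mem p P ∧ U = (fun d : α ⊕ β → M => d ∘ Sum.inl) ⁻¹' P} ∪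
      {U | ∃ Q, Mem q Q ∧ U = (fun d : α ⊕ β → M => d ∘ Sum.inr) ⁻¹' Q}) ∪ {S}) (by
    rintro U ((⟨P, hP, rfl⟩ | ⟨Q, hQ, rfl⟩) | rfl)
    · exact hP.definable.preimage_comp _
    · exact hQ.definable.preimage_comp _
    · exact hS) (by
    intro F₀ hF₀ hfin
    have hPQ : ∀ U ∈ F₀, ∃ P Q, Mem p P ∧ Mem q Q ∧
        ∀ a ∈ P, ∀ b ∈ Q, Sum.elim a b ∈ S → Sum.elim a b ∈ U := by
      intro U hU
      rcases hF₀ hU with (⟨P, hP, rfl⟩ | ⟨Q, hQ, rfl⟩) | rfl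
      · exact ⟨P, Set.univ, hP, mem_univ q, fun a ha b _ _ => ha⟩
      · exact ⟨Set.univ, Q, mem_univ p, hQ, fun a _ b hb _ => hb⟩
      · exact ⟨Set.univ, Set.univ, mem_univ p, mem_univ q, fun a _ b _ h => h⟩
    choose! P Q hP hQ hU using hPQ
    obtain ⟨a, ha, b, hb, hab⟩ := h _ _
      (mem_biInter hfin.toFinset P fun U hU => hP U (hfin.mem_toFinset.1 hU))
      (mem_biInter hfin.toFinset Q fun U hU => hQ U (hfin.mem_toFinset.1 hU))
    refine ⟨Sum.elim a b, fun U hUF => hU U hUF a ?_ b ?_ hab⟩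
    · exact Set.mem_iInter₂.1 ha U (hfin.mem_toFinset.2 hUF)
    · exact Set.mem_iInter₂.1 hb U (hfin.mem_toFinset.2 hUF))
  exact ⟨s, ⟨fun P hP => hs _ (Or.inl (Or.inl ⟨P, hP, rfl⟩)),
    fun Q hQ => hs _ (Or.inl (Or.inr ⟨Q, hQ, rfl⟩))⟩, hs S (Or.inr rfl)⟩

theorem orthogonal_iff_forall_eq [Nonempty M] {p : GlobalType L M α} {q : GlobalType L M β} :
    Orthogonal p q ↔ ∀ s s', IsCompletion p q s → IsCompletion p q s' → s = s' := by
  rw [orthogonal_iff_existsUnique]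
  refine ⟨fun h s s' hs hs' => h.unique hs hs', fun h => ?_⟩
  obtain ⟨s, hs, -⟩ := exists_isCompletion_mem (p := p) (q := q)
    (Set.definable_univ (A := Set.univ) (L := L)) (by
      intro P Q hP hQ
      obtain ⟨a, ha⟩ := hP.nonempty
      obtain ⟨b, hb⟩ := hQ.nonempty
      exact ⟨a, ha, b, hb, trivial⟩)
  exact ⟨s, hs, fun s' hs' => h s' s hs' hs⟩

/-- Global types are orthogonal if and only if every definable relation is decided by a pair of
their members. -/
theorem orthogonal_iff_decides [Nonempty M] {p : GlobalType L M α} {q : GlobalType L M β} :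
    Orthogonal p q ↔ ∀ S : Set (α ⊕ β → M), (Set.univ : Set M).Definable L S →
      ∃ P Q, Mem p P ∧ Mem q Q ∧
        ((∀ a ∈ P, ∀ b ∈ Q, Sum.elim a b ∈ S) ∨ ∀ a ∈ P, ∀ b ∈ Q, Sum.elim a b ∉ S) := by
  rw [orthogonal_iff_forall_eq]
  constructor
  · intro h S hS
    by_contra! hn
    -- An undecided `S` is consistent with `p ∪ q`, and so is its complement; this gives two
    -- different completions.
    obtain ⟨s, hs, hsS⟩ := exists_isCompletion_mem hS fun P Q hP hQ => (hn P Q hP hQ).2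
    obtain ⟨s', hs', hsS'⟩ := exists_isCompletion_mem hS.compl fun P Q hP hQ => (hn P Q hP hQ).1
    rw [h s' s hs' hs] at hsS'
    exact (mem_compl_iff hS).1 hsS' hsS
  · intro h s s' hs hs'
    refine eq_of_mem_imp fun S hS => ?_
    obtain ⟨P, Q, hP, hQ, h | h⟩ := h S hS.definable
    · refine mem_of_inter_subset (hs'.1 P hP) (hs'.2 Q hQ) hS.definable fun d hd => ?_
      have := h _ hd.1 _ hd.2
      rwa [Sum.elim_comp_inl_inr] at this
    · refine absurd hS ((mem_compl_iff hS.definable).1 (mem_of_inter_subset (hs.1 P hP)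
        (hs.2 Q hQ) hS.definable.compl fun d hd => ?_))
      have := h _ hd.1 _ hd.2
      rwa [Sum.elim_comp_inl_inr] at this

/-- Orthogonality passes to images under coordinate maps, in particular from a product to its
factors. -/
theorem Orthogonal.of_comp [Nonempty M] {p : GlobalType L M α} {q : GlobalType L M β}
    {r : GlobalType L M γ} (h : Orthogonal p r) (f : β → γ)
    (hf : ∀ Q, Mem q Q → Mem r ((fun d : γ → M => d ∘ f) ⁻¹' Q)) : Orthogonal p q := by
  rw [orthogonal_iff_decides] at h ⊢
  intro S hS
  obtain ⟨P, R, hP, hR, hPR⟩ := h _ (hS.preimage_comp (Sum.map id f))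
  have hdef := hR.definable.image_comp f
  have hcomp : ∀ (a : α → M) (c : γ → M),
      Sum.elim a c ∘ Sum.map id f = Sum.elim a (c ∘ f) := by
    intro a c
    ext i
    cases i <;> rfl
  -- The image of `R` is definable and lies in `q`: otherwise the preimage of its complement would
  -- be in `r` and so meet `R`.
  refine ⟨P, (fun d : γ → M => d ∘ f) '' R, hP, ?_, hPR.imp ?_ ?_⟩
  · by_contra hn
    obtain ⟨c, hc, hc'⟩ := (hR.inter (hf _ ((mem_compl_iff hdef).2 hn))).nonempty
    exact hc' ⟨c, hc, rfl⟩
  · rintro h a ha _ ⟨c, hc, rfl⟩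
    have := h a ha c hc
    rwa [Set.mem_preimage, hcomp] at this
  · rintro h a ha _ ⟨c, hc, rfl⟩
    have := h a ha c hc
    rwa [Set.mem_preimage, hcomp] at this

/-! ### Products -/

theorem mem_prod_iff [Nonempty M] {κ : Cardinal.{w}} (hM : IsMonster L M κ)
    (q : GlobalType L M β) (r : GlobalType L M γ) (hr : Invariant κ r) {S : Set (β ⊕ γ → M)}
    (hS : (Set.univ : Set M).Definable L S) :
    Mem (prod hM q r hr) S ↔
      ∃ D : Set M, #D < κ ∧ ∀ b : β → M, Realizes q D b → Mem r (fiber S b) := by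
  obtain ⟨φ, hφ⟩ := definable_univ_iff_exists.1 hS
  rw [mem_iff_has hφ]
  change ProdHas κ q r (toSentence.symm (toSentence φ)) ↔ _
  rw [Equiv.symm_apply_apply]
  have hb : ∀ b : β → M, Mem r (fiber S b) ↔ Has r (substLeft φ b) := by
    refine fun b => mem_iff_has fun c => (hφ _).trans ?_
    rw [substLeft, Formula.realize_relabel]
    exact iff_of_eq (congrArg _ (by ext i; rcases i with i | i | i <;> rfl))
  simp only [hb]
  rfl

theorem mem_prod_comp_inl [Nonempty M] {κ : Cardinal.{w}} (hM : IsMonster L M κ)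
    (q : GlobalType L M β) (r : GlobalType L M γ) (hr : Invariant κ r) {Q : Set (β → M)}
    (hQ : Mem q Q) :
    Mem (prod hM q r hr) ((fun d : β ⊕ γ → M => d ∘ Sum.inl) ⁻¹' Q) := by
  rw [mem_prod_iff hM q r hr (hQ.definable.preimage_comp _)]
  obtain ⟨D, -, hD⟩ := Set.definable_iff_finitely_definable.1 hQ.definable
  refine ⟨D, (lt_aleph0_iff_set_finite.2 D.finite_toSet).trans hM.aleph0_lt, fun b hb => ?_⟩
  have hbQ : b ∈ Q := (hb.mem_iff hD).2 hQ
  convert mem_univ r using 1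
  exact Set.eq_univ_of_forall fun c => hbQ

theorem mem_prod_comp_inr [Nonempty M] {κ : Cardinal.{w}} (hM : IsMonster L M κ)
    (q : GlobalType L M β) (r : GlobalType L M γ) (hr : Invariant κ r) {R : Set (γ → M)}
    (hR : Mem r R) :
    Mem (prod hM q r hr) ((fun d : β ⊕ γ → M => d ∘ Sum.inr) ⁻¹' R) := by
  rw [mem_prod_iff hM q r hr (hR.definable.preimage_comp _)]
  exact ⟨∅, by simpa using aleph0_pos.trans hM.aleph0_lt, fun b _ => hR⟩

/-- For `T` over `A`, invariance of `r` lets `A` itself be the small set witnessing membership in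
the product. -/
theorem realizes_of_realizes_prod [Nonempty M] {κ : Cardinal.{w}} (hM : IsMonster L M κ)
    {q : GlobalType L M β} {r : GlobalType L M γ} {hr : Invariant κ r} {A : Set M}
    (hA : #A < κ) (hrA : InvariantOver r A) {b : β → M} {c : γ → M}
    (h : Realizes (prod hM q r hr) A (Sum.elim b c)) :
    Realizes q A b ∧ Realizes r (A ∪ Set.range b) c := by
  have hb : Realizes q A b := realizes_iff_mem.2 fun Q hQ hqQ =>
    realizes_iff_mem.1 h _ (hQ.preimage_comp _) (mem_prod_comp_inl hM q r hr hqQ)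
  refine ⟨hb, realizes_union_range_iff.2 fun T hT hrT => realizes_iff_mem.1 h T hT ?_⟩
  exact (mem_prod_iff hM q r hr (hT.mono (Set.subset_univ _))).2 ⟨A, hA, fun b' hb' =>
    (hrA.mem_fiber_iff (hb.sameType hb') hT).1 hrT⟩

theorem RegularOver.mono {κ : Cardinal.{w}} {p : GlobalType L M α} {A B : Set M}
    (h : RegularOver κ p A) (hAB : A ⊆ B) : RegularOver κ p B :=
  ⟨h.1, h.2.1.mono hAB, fun C hC hBC a ha => h.2.2 C hC (hAB.trans hBC) a (ha.mono hAB)⟩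

/-- Realizations over a small set of a regular, generically stable type and of an orthogonal
invariant type are independent. -/
theorem Orthogonal.realizes [Nonempty M] {κ : Cardinal.{w}} (hM : IsMonster L M κ)
    {p : GlobalType L M α} (hp : GenericallyStable κ p) {r : GlobalType L M γ}
    (hpr : Orthogonal p r) {A : Set M} (hA : #A < κ) (hreg : RegularOver κ p A)
    (hrA : InvariantOver r A) {a : α → M} {c : γ → M} (ha : Realizes p A a)
    (hc : Realizes r A c) : Realizes p (A ∪ Set.range c) a := by
  have hpA := hreg.2.1
  refine realizes_union_range_iff.2 fun T hT hpT => ?_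
  obtain ⟨P, Q, hP, hQ, hPQ⟩ := orthogonal_iff_decides.1 hpr _
    ((hT.mono (Set.subset_univ _)).preimage_comp Sum.swap)
  have hswap : ∀ (a : α → M) (c : γ → M),
      Sum.elim a c ∈ (fun g : α ⊕ γ → M => g ∘ Sum.swap) ⁻¹' T ↔ Sum.elim c a ∈ T := by
    intro a c
    rw [Set.mem_preimage, show Sum.elim a c ∘ Sum.swap = Sum.elim c a by ext i; cases i <;> rfl]
  simp only [hswap] at hPQ
  obtain ⟨C₁, -, hC₁⟩ := Set.definable_iff_finitely_definable.1 hP.definable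
  obtain ⟨C₂, -, hC₂⟩ := Set.definable_iff_finitely_definable.1 hQ.definable
  -- The finite tuple of all parameters of the deciding sets `P` and `Q`, which need not lie in `A`.
  let e : C₁ ⊕ C₂ → M := Sum.elim Subtype.val Subtype.val
  obtain ⟨P', hP', rfl⟩ := exists_eq_fiber (A := A) (c := e)
    (hC₁.mono fun m hm => Or.inr ⟨Sum.inl ⟨m, hm⟩, rfl⟩)
  obtain ⟨Q', hQ', rfl⟩ := exists_eq_fiber (A := A) (c := e)
    (hC₂.mono fun m hm => Or.inr ⟨Sum.inr ⟨m, hm⟩, rfl⟩)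
  have hAe := small_union_small hM.aleph0_lt hA (small_range hM.aleph0_lt e)
  obtain ⟨c', hc'⟩ := exists_realizes hM.saturated r hAe
  have hcc' : SameType L A c' c := (hc'.mono Set.subset_union_left).sameType hc
  have hpos : ∀ a ∈ fiber P' e, ∀ c ∈ fiber Q' e, Sum.elim c a ∈ T := by
    -- The pair decides positively, as witnessed by `c'` generic over `Ae` and `a'` generic over
    -- `Aec'`.
    refine hPQ.resolve_right fun hneg => ?_
    obtain ⟨a', ha'⟩ := exists_realizes hM.saturated p
      (small_union_small hM.aleph0_lt hAe (small_range hM.aleph0_lt c'))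
    refine hneg a' ?_ c' ((hc'.elim_mem_iff hQ').2 hQ) ?_
    · exact ((ha'.mono Set.subset_union_left).elim_mem_iff hP').2 hP
    · exact ((ha'.mono (Set.union_subset_union_left _ Set.subset_union_left)).elim_mem_iff hT).2
        ((hpA.mem_fiber_iff hcc' hT).2 hpT)
  -- The given `c` need not be generic over `e`, so the parameters are moved to `e'` over which it
  -- is. Weight one for `e'` and `c` leaves two cases: `a` generic over `e'`, where the conjugates
  -- of `P` and `Q` decide `T`, or `a` generic over `c`, which suffices directly.
  obtain ⟨e', he'⟩ := hM.exists_sameType hA hcc' e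
  have hee' : SameType L A e e' := he'.comp Sum.inr
  have hce' : Realizes r (A ∪ Set.range e') c := by
    refine hc'.of_sameType_elim hrA ?_
    convert he'.comp Sum.swap using 1 <;> (ext i; cases i <;> rfl)
  rcases hreg.realizes_or_realizes hM hp hA hrA hce' ha with h | h
  · have haP := (h.elim_mem_iff hP').2 ((hpA.mem_fiber_iff hee' hP').1 hP)
    have hcQ := (hce'.elim_mem_iff hQ').2 ((hrA.mem_fiber_iff hee' hQ').1 hQ)
    obtain ⟨d, hd⟩ := hM.exists_sameType hA hee'.symm (Sum.elim c a)
    have hd₁ : SameType L A (Sum.elim e' a) (Sum.elim e (d ∘ Sum.inr)) := by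
      convert hd.comp (Sum.map id Sum.inr) using 1 <;> (ext i; cases i <;> rfl)
    have hd₂ : SameType L A (Sum.elim e' c) (Sum.elim e (d ∘ Sum.inl)) := by
      convert hd.comp (Sum.map id Sum.inl) using 1 <;> (ext i; cases i <;> rfl)
    have h := hpos _ ((sameType_iff.1 hd₁ P' hP').1 haP) _ ((sameType_iff.1 hd₂ Q' hQ').1 hcQ)
    rw [Sum.elim_comp_inl_inr] at h
    exact (sameType_iff.1 (hd.comp Sum.inr) T hT).2 h
  · exact (h.elim_mem_iff hT).2 hpT

theorem Orthogonal.prod [Nonempty M] {κ : Cardinal.{w}} (hM : IsMonster L M κ)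
    {p : GlobalType L M α} (hp : GenericallyStable κ p) (hreg : Regular κ p)
    {q : GlobalType L M β} {r : GlobalType L M γ} (hq : Invariant κ q) (hr : Invariant κ r)
    (hpq : Orthogonal p q) (hpr : Orthogonal p r) :
    Orthogonal p (MonsterModel.prod hM q r hr) := by
  have hκ := hM.aleph0_lt
  obtain ⟨A₁, hA₁, hreg⟩ := hreg
  obtain ⟨A₂, hA₂, hq⟩ := hq
  obtain ⟨A₃, hA₃, hr'⟩ := id hr
  rw [orthogonal_iff_forall_eq]
  intro s s' hs hs'
  refine eq_of_mem_imp fun S hS => ?_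
  obtain ⟨C, -, hC⟩ := Set.definable_iff_finitely_definable.1 hS.definable
  obtain ⟨A, hA, h₁, h₂, h₃, hCA⟩ : ∃ A : Set M, #A < κ ∧ A₁ ⊆ A ∧ A₂ ⊆ A ∧ A₃ ⊆ A ∧ ↑C ⊆ A :=
    ⟨A₁ ∪ A₂ ∪ A₃ ∪ C, small_union hκ (small_union_small hκ (small_union_small hκ hA₁ hA₂) hA₃)
      C.finite_toSet, fun m hm => Or.inl (Or.inl (Or.inl hm)),
      fun m hm => Or.inl (Or.inl (Or.inr hm)), fun m hm => Or.inl (Or.inr hm), fun m hm => Or.inr hm⟩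
  -- In any completion the `p`-part is generic over the product part, so invariance of `p` fixes the
  -- type over `A`, which contains the parameters of `S`.
  have key : ∀ s, IsCompletion p (MonsterModel.prod hM q r hr) s → ∀ d, Realizes s A d →
      Realizes (MonsterModel.prod hM q r hr) A (d ∘ Sum.inr) ∧
        Realizes p (A ∪ Set.range (d ∘ Sum.inr)) (d ∘ Sum.inl) := by
    intro s hs d hd
    have ha : Realizes p A (d ∘ Sum.inl) := realizes_iff_mem.2 fun P hP hpP =>
      realizes_iff_mem.1 hd _ (hP.preimage_comp _) (hs.1 P hpP)
    have hbc : Realizes (MonsterModel.prod hM q r hr) A (d ∘ Sum.inr) :=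
      realizes_iff_mem.2 fun P hP hpP =>
        realizes_iff_mem.1 hd _ (hP.preimage_comp _) (hs.2 P hpP)
    refine ⟨hbc, ?_⟩
    rw [← Sum.elim_comp_inl_inr (d ∘ Sum.inr)] at hbc ⊢
    obtain ⟨hb, hc⟩ := realizes_of_realizes_prod hM hA (hr'.mono h₃) hbc
    have hab := hpq.realizes hM hp hA (hreg.mono h₁) (hq.mono h₂) ha hb
    rw [Set.Sum.elim_range, ← Set.union_assoc]
    exact hpr.realizes hM hp (small_union_small hκ hA (small_range hκ _))
      (hreg.mono (h₁.trans Set.subset_union_left)) (hr'.mono (h₃.trans Set.subset_union_left))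
      hab hc
  obtain ⟨d, hd⟩ := exists_realizes hM.saturated s hA
  obtain ⟨d', hd'⟩ := exists_realizes hM.saturated s' hA
  obtain ⟨hbc, ha⟩ := key s hs d hd
  obtain ⟨hbc', ha'⟩ := key s' hs' d' hd'
  have hdd' : SameType L A d d' := by
    convert (Realizes.sameType_elim (hreg.2.1.mono h₁) (hbc.sameType hbc') ha ha').comp
      Sum.swap using 1 <;> (ext i; cases i <;> rfl)
  have hSA := hC.mono hCA
  exact (hd'.mem_iff hSA).1 ((sameType_iff.1 hdd' S hSA).1 ((hd.mem_iff hSA).2 hS))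

end Orthogonality

end MonsterModel

theorem mainTheorem2 {L : FirstOrder.Language} {M : Type*} [L.Structure M] [Nonempty M]
    {κ : Cardinal} (hM : MonsterModel.IsMonster L M κ)
    {α β γ : Type*} [Finite α] [Finite β] [Finite γ]
    (p : MonsterModel.GlobalType L M α) (q : MonsterModel.GlobalType L M β)
    (r : MonsterModel.GlobalType L M γ)
    (hp : MonsterModel.GenericallyStable κ p)
    (hq : MonsterModel.Invariant κ q) (hr : MonsterModel.Invariant κ r) :
    (∀ A : Set M, Cardinal.mk A < κ → MonsterModel.RegularOver κ p A →
      MonsterModel.InvariantOver q A → MonsterModel.InvariantOver r A →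
      ∀ (a : α → M) (b : β → M) (c : γ → M),
        MonsterModel.Realizes (MonsterModel.prod hM q r hr) A (Sum.elim b c) →
        MonsterModel.Realizes p A a →
        MonsterModel.Realizes p (A ∪ Set.range b) a ∨
          MonsterModel.Realizes p (A ∪ Set.range c) a) ∧
    (MonsterModel.Regular κ p →
      (MonsterModel.Orthogonal p (MonsterModel.prod hM q r hr) ↔
        MonsterModel.Orthogonal p q ∧ MonsterModel.Orthogonal p r)) := by
  refine ⟨fun A hA hreg _ hrA a b c hbc ha => ?_, fun hreg => ⟨fun h => ⟨?_, ?_⟩, fun h => ?_⟩⟩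
  · exact hreg.realizes_or_realizes hM hp hA hrA
      (MonsterModel.realizes_of_realizes_prod hM hA hrA hbc).2 ha
  · exact h.of_comp Sum.inl fun Q => MonsterModel.mem_prod_comp_inl hM q r hr
  · exact h.of_comp Sum.inr fun R => MonsterModel.mem_prod_comp_inr hM q r hr
  · exact h.1.prod hM hp hreg hq hr h.2
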